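/- **Notation.** For an open set $\Omega\subset\mathbb C$ let $\mathcal H(\Omega)$ be the space of holomorphic functions on $\Omega$ with the topology of uniform convergence on compact subsets of $\Omega$. For $f\in\mathcal H(\Omega)$ and $\zeta\in\Omega$ let $a_\nu=f^{(\nu)}(\zeta)/\nu!$ for $\nu\ge 0$ and $a_\nu=0$ for $\nu<0$. For $p,q\in\mathbb N=\{0,1,2,\dots\}$ write $f\in\mathfrak D_{p,q}(\zeta)$ if the $q\times q$ Hankel determinant $\det\,(a_{p-q+1+i+j})_{0\le i,j<q}$ is nonzero (for $q=0$ this always holds). In that case there is exactly one rational function $[p/q]_{f,\zeta}=A/B$, where $A,B$ are polynomials with $\deg A\le p$, $\deg B\le q$, $B(\zeta)=1$, whose Taylor coefficients at $\zeta$ of order $0,1,\dots,p+q$ are $a_0,\dots,a_{p+q}$; it is the Padé approximant of $f$ with center $\zeta$. At a pole $z$ of $[p/q]_{f,\zeta}$ we put $|[p/q]_{f,\zeta}(z)-w|=\infty$ for all $w\in\mathbb C$. A supremum over the empty set is $0$. **Theorem 3.1.** Let $\mathfrak F\subset\mathbb N\times\mathbb N$ contain a sequence $(\tilde p_n,\tilde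 q_n)$, $n=1,2,\dots$, with $\tilde p_n\to+\infty$. Let $\Omega\subset\mathbb C$ be a simply connected open set (that is, an open set each of whose connected components is simply connected; in particular $\Omega$ may be any simply connected domain), let $L,L'\subset\Omega$ be compact, and let $K\subset\mathbb C\setminus\Omega$ be a compact set with connected complement. Let $\mathcal Y$ be the set of all $f\in\mathcal H(\Omega)$ such that for every polynomial $h$ there is a sequence $(p_n,q_n)\in\mathfrak F$, $n=1,2,\dots$, with 1. $f\in\mathfrak D_{p_n,q_n}(\zeta)$ for every $n$ and every $\zeta\in L$, 2. $\sup_{\zeta\in L,\,z\in K}\left|[p_n/q_n]_{f,\zeta}(z)-h(z)\right|\to 0$ as $n\to\infty$, 3. $\sup_{\zeta\in L,\,z\in L'}\left|[p_n/q_n]_{f,\zeta}(z)-f(z)\right|\to 0$ as $n\to\infty$. Then $\mathcal Y$ is nonempty, and it is a dense $G_\delta$ subset of $\mathcal H(\Omega)$. -/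

import Mathlib

open Filter Topology Polynomial
open scoped ENNReal

noncomputable section

/-- A simply connected open subset of the plane: open, and each of its connected components is
simply connected. A connected set of this kind is a simply connected domain. -/
def IsSimplyConnectedOpen (Ω : Set ℂ) : Prop :=
  IsOpen Ω ∧ ∀ z ∈ Ω, IsSimplyConnected (connectedComponentIn Ω z)

/-- Simply connected domains are simply connected open sets. -/
theorem IsSimplyConnectedOpen.of_isSimplyConnected {Ω : Set ℂ} (ho : IsOpen Ω)
    (hs : IsSimplyConnected Ω) : IsSimplyConnectedOpen Ω := by
  refine ⟨ho, fun z hz => ?_⟩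
  rw [hs.isPathConnected.isConnected.isPreconnected.connectedComponentIn hz]
  exact hs

/-- The extension by `0` of a function on `Ω` to the whole plane. -/
def zeroExt {Ω : Set ℂ} (f : C(Ω, ℂ)) : ℂ → ℂ :=
  Function.extend Subtype.val f 0

/-- The space of holomorphic functions on the open set `Ω`. As a subspace of `C(Ω, ℂ)` with its
compact-open topology it carries the topology of uniform convergence on compact subsets of `Ω`. -/
abbrev HolSpace (Ω : Set ℂ) : Type :=
  {f : C(Ω, ℂ) // DifferentiableOn ℂ (zeroExt f) Ω}

/-- The `ν`-th Taylor coefficient `f⁽ᵛ⁾(ζ) / ν!` of `f` at `ζ`. -/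
def taylorCoeff (f : ℂ → ℂ) (ζ : ℂ) (ν : ℕ) : ℂ :=
  iteratedDeriv ν f ζ / (ν.factorial : ℂ)

/-- Taylor coefficients with an integer index: they vanish at negative indices. -/
def taylorCoeffInt (f : ℂ → ℂ) (ζ : ℂ) (m : ℤ) : ℂ :=
  if m < 0 then 0 else taylorCoeff f ζ m.toNat

/-- The `q × q` Hankel matrix with entries `a_{p-q+1+i+j}`, for `0 ≤ i, j < q`. -/
def hankelMatrix (f : ℂ → ℂ) (ζ : ℂ) (p q : ℕ) : Matrix (Fin q) (Fin q) ℂ :=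
  Matrix.of fun i j =>
    taylorCoeffInt f ζ ((p : ℤ) - (q : ℤ) + 1 + ((i : ℕ) : ℤ) + ((j : ℕ) : ℤ))

/-- The class `𝔇_{p,q}(ζ)`: the Hankel determinant does not vanish. -/
def InPadeClass (f : ℂ → ℂ) (ζ : ℂ) (p q : ℕ) : Prop :=
  (hankelMatrix f ζ p q).det ≠ 0

/-- The rational function `Φ` is a `(p, q)` Padé approximant of `f` with center `ζ`: it can be
written as `A / B` with `deg A ≤ p`, `deg B ≤ q` and `B(ζ) = 1`, and its Taylor coefficients at
`ζ` of order at most `p + q` are those of `f`. -/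
def IsPade (f : ℂ → ℂ) (ζ : ℂ) (p q : ℕ) (Φ : RatFunc ℂ) : Prop :=
  ∃ A B : ℂ[X], A.natDegree ≤ p ∧ B.natDegree ≤ q ∧ B.eval ζ = 1 ∧
    Φ = algebraMap ℂ[X] (RatFunc ℂ) A / algebraMap ℂ[X] (RatFunc ℂ) B ∧
    ∀ ν ≤ p + q, taylorCoeff (fun z => A.eval z / B.eval z) ζ ν = taylorCoeff f ζ ν

open Classical in
/-- The Padé approximant `[p/q]_{f,ζ}`: the rational function `Φ` with `IsPade f ζ p q Φ`, which
is unique if it exists. (The value `0` if there is none is never used: for `f` in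
`𝔇_{p,q}(ζ)` the approximant exists.) -/
def pade (f : ℂ → ℂ) (ζ : ℂ) (p q : ℕ) : RatFunc ℂ :=
  if h : ∃ Φ, IsPade f ζ p q Φ then h.choose else 0

open Classical in
/-- The distance `|Φ(z) - w|` of the value at `z` of a rational function from `w ∈ ℂ`; it is `∞`
if `z` is a pole of `Φ`. -/
def ratFuncDist (Φ : RatFunc ℂ) (z w : ℂ) : ℝ≥0∞ :=
  if Φ.denom.eval z = 0 then ⊤ else ‖Φ.num.eval z / Φ.denom.eval z - w‖ₑ

/-- `sup_{ζ ∈ L, z ∈ S} |[p/q]_{f,ζ}(z) - g(z)|`. -/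
def padeSupDist (f : ℂ → ℂ) (p q : ℕ) (L S : Set ℂ) (g : ℂ → ℂ) : ℝ≥0∞ :=
  ⨆ ζ ∈ L, ⨆ z ∈ S, ratFuncDist (pade f ζ p q) z (g z)

/-- The set of the functions `f`, holomorphic on `Ω`, such that for every polynomial `h` there is a
sequence `(pₙ, qₙ)` in `F` such that `f ∈ 𝔇_{pₙ,qₙ}(ζ)` for all `n` and `ζ ∈ L`, and such that
`[pₙ/qₙ]_{f,ζ}(z)` tends to `h(z)` uniformly in `(ζ, z) ∈ L × K` and to `f(z)` uniformly in
`(ζ, z) ∈ L × L'`. -/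
def universalPade (F : Set (ℕ × ℕ)) (Ω L L' K : Set ℂ) : Set (HolSpace Ω) :=
  {f | ∀ h : ℂ[X], ∃ s : ℕ → ℕ × ℕ,
    (∀ n, s n ∈ F) ∧
    (∀ n, ∀ ζ ∈ L, InPadeClass (zeroExt f.1) ζ (s n).1 (s n).2) ∧
    Tendsto (fun n => padeSupDist (zeroExt f.1) (s n).1 (s n).2 L K fun z => h.eval z)
      atTop (𝓝 0) ∧
    Tendsto (fun n => padeSupDist (zeroExt f.1) (s n).1 (s n).2 L L' (zeroExt f.1))
      atTop (𝓝 0)}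

end

noncomputable section

/-! ### Continuous logarithms and components of the complement -/

/-- The function `z ↦ z - a` has a continuous logarithm on `X`. -/
def HasLog (X : Set ℂ) (a : ℂ) : Prop :=
  ∃ φ : ℂ → ℂ, ContinuousOn φ X ∧ ∀ z ∈ X, Complex.exp (φ z) = z - a

theorem HasLog.notMem {X : Set ℂ} {a : ℂ} (h : HasLog X a) : a ∉ X := by
  obtain ⟨φ, -, hφ⟩ := h
  intro ha
  have := hφ a ha
  rw [sub_self] at this
  exact Complex.exp_ne_zero _ this

theorem HasLog.mono {X Y : Set ℂ} {a : ℂ} (h : HasLog X a) (hY : Y ⊆ X) : HasLog Y a := by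
  obtain ⟨φ, hc, hφ⟩ := h
  exact ⟨φ, hc.mono hY, fun z hz => hφ z (hY hz)⟩

/-- Factor `z - b = (z - a) (1 + (a - b) / (z - a))`; the second factor stays in the unit disc about
`1`, where the principal logarithm is continuous. -/
theorem HasLog.of_near {X : Set ℂ} {a b : ℂ} (h : HasLog X a)
    (hab : ∀ z ∈ X, ‖a - b‖ < ‖z - a‖) : HasLog X b := by
  obtain ⟨φ, hc, hφ⟩ := h
  have hne : ∀ z ∈ X, z - a ≠ 0 := fun z hz =>
    norm_pos_iff.1 ((norm_nonneg _).trans_lt (hab z hz))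
  have hs : ∀ z ∈ X, 1 + (a - b) / (z - a) ∈ Complex.slitPlane := fun z hz => by
    apply Complex.mem_slitPlane_of_norm_lt_one
    rw [norm_div, div_lt_one (norm_pos_iff.2 (hne z hz))]
    exact hab z hz
  refine ⟨fun z => φ z + Complex.log (1 + (a - b) / (z - a)), hc.add ?_, fun z hz => ?_⟩
  · refine ContinuousOn.clog ?_ hs
    exact continuousOn_const.add (continuousOn_const.div (by fun_prop) hne)
  · rw [Complex.exp_add, hφ z hz, Complex.exp_log (Complex.slitPlane_ne_zero (hs z hz))]
    have := hne z hz
    field_simp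
    ring

theorem HasLog.of_norm_lt {X : Set ℂ} {a : ℂ} (h : ∀ z ∈ X, ‖z‖ < ‖a‖) : HasLog X a := by
  rcases X.eq_empty_or_nonempty with rfl | ⟨x, hx⟩
  · exact ⟨0, by simp, by simp⟩
  have ha : a ≠ 0 := norm_pos_iff.1 ((norm_nonneg _).trans_lt (h x hx))
  have hs : ∀ z ∈ X, 1 + -(z / a) ∈ Complex.slitPlane := fun z hz => by
    apply Complex.mem_slitPlane_of_norm_lt_one
    rw [norm_neg, norm_div, div_lt_one (norm_pos_iff.2 ha)]
    exact h z hz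
  refine ⟨fun z => Complex.log (-a) + Complex.log (1 + -(z / a)),
    continuousOn_const.add ?_, fun z hz => ?_⟩
  · exact ContinuousOn.clog (by fun_prop) hs
  · rw [Complex.exp_add, Complex.exp_log (neg_ne_zero.2 ha),
      Complex.exp_log (Complex.slitPlane_ne_zero (hs z hz))]
    field_simp
    ring

theorem eventually_hasLog_iff {X : Set ℂ} (hX : IsClosed X) {a : ℂ} (ha : a ∉ X) :
    ∀ᶠ b in 𝓝 a, (HasLog X a ↔ HasLog X b) := by
  obtain ⟨r, hr, hrX⟩ := Metric.isOpen_iff.1 hX.isOpen_compl a ha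
  have hr' : ∀ z ∈ X, r ≤ ‖z - a‖ := fun z hz => by
    by_contra! hlt
    exact hrX (mem_ball_iff_norm.2 hlt) hz
  filter_upwards [Metric.ball_mem_nhds a (half_pos hr)] with b hb
  rw [mem_ball_iff_norm] at hb
  refine ⟨fun h => h.of_near fun z hz => ?_, fun h => h.of_near fun z hz => ?_⟩
  · rw [norm_sub_rev]
    linarith [hr' z hz]
  · have h1 := norm_sub_le_norm_sub_add_norm_sub z b a
    linarith [hr' z hz]

theorem isOpen_setOf_hasLog {X : Set ℂ} (hX : IsClosed X) : IsOpen {a | HasLog X a} := by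
  rw [isOpen_iff_mem_nhds]
  intro a ha
  filter_upwards [eventually_hasLog_iff hX (HasLog.notMem ha)] with b hb
  exact hb.1 ha

/-- The property is locally constant in `a` off `K` and holds for `a` far away, so it spreads over
the connected complement. -/
theorem hasLog_of_isConnected_compl {K : Set ℂ} (hK : IsCompact K) (hc : IsPreconnected Kᶜ) {a : ℂ}
    (ha : a ∉ K) : HasLog K a := by
  obtain ⟨R, hR⟩ := hK.isBounded.exists_norm_le
  have hlarge : HasLog K ((|R| + 1 : ℝ) : ℂ) := by
    refine HasLog.of_norm_lt fun z hz => ?_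
    rw [Complex.norm_real, Real.norm_of_nonneg (by positivity)]
    exact (hR z hz).trans_lt (by linarith [le_abs_self R])
  have hsub : Kᶜ ⊆ {a | HasLog K a} := by
    refine hc.subset_of_closure_inter_subset (isOpen_setOf_hasLog hK.isClosed)
      ⟨_, hlarge.notMem, hlarge⟩ ?_
    rintro b ⟨hb, hbK⟩
    obtain ⟨c, hc1, hc2⟩ :=
      mem_closure_iff_nhds.1 hb _ (eventually_hasLog_iff hK.isClosed hbK)
    exact hc1.2 hc2
  exact hsub ha

theorem HasLog.union {X Y : Set ℂ} {a : ℂ} (hX : IsClosed X) (hY : IsClosed Y)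
    (hXY : Disjoint X Y) (h1 : HasLog X a) (h2 : HasLog Y a) : HasLog (X ∪ Y) a := by
  classical
  obtain ⟨φ, hc, hφ⟩ := h1
  obtain ⟨ψ, hd, hψ⟩ := h2
  have e1 : Set.EqOn (X.piecewise φ ψ) φ X := Set.piecewise_eqOn _ _ _
  have e2 : Set.EqOn (X.piecewise φ ψ) ψ Y := fun z hz =>
    Set.piecewise_eq_of_notMem _ _ _ (hXY.notMem_of_mem_right hz)
  refine ⟨X.piecewise φ ψ, (hc.congr e1).union_of_isClosed (hd.congr e2) hX hY, ?_⟩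
  rintro z (hz | hz)
  · rw [e1 hz, hφ z hz]
  · rw [e2 hz, hψ z hz]

theorem IsSimplyConnectedOpen.hasLog {Ω : Set ℂ} (hΩ : IsSimplyConnectedOpen Ω) {a : ℂ}
    (ha : a ∉ Ω) : HasLog Ω a := by
  -- The branch is chosen per component, as a set, so that all points of one component share it and
  -- continuity is local.
  have key : ∀ C : Set ℂ, ∃ φ : ℂ → ℂ, ∀ z ∈ Ω, C = connectedComponentIn Ω z →
      ContinuousOn φ C ∧ ∀ w ∈ C, Complex.exp (φ w) = w - a := by
    intro C
    by_cases hC : ∃ z ∈ Ω, C = connectedComponentIn Ω z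
    · obtain ⟨z, hz, rfl⟩ := hC
      obtain ⟨φ, h1, h2⟩ := Complex.exists_continuousOn_eqOn_exp_comp (hΩ.2 z hz)
        (hΩ.1.connectedComponentIn) (g := fun w => w - a) (by fun_prop) (by
          rintro ⟨w, hw, hw0⟩
          exact ha (sub_eq_zero.1 hw0 ▸ connectedComponentIn_subset _ _ hw))
      exact ⟨φ, fun _ _ _ => ⟨h1, h2⟩⟩
    · exact ⟨0, fun z hz h => (hC ⟨z, hz, h⟩).elim⟩
  choose c hc using key
  refine ⟨fun z => c (connectedComponentIn Ω z) z, fun z hz => ?_, fun z hz =>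
    (hc _ z hz rfl).2 z (mem_connectedComponentIn hz)⟩
  have hn : connectedComponentIn Ω z ∈ 𝓝 z :=
    hΩ.1.connectedComponentIn.mem_nhds (mem_connectedComponentIn hz)
  refine ContinuousAt.continuousWithinAt ?_
  refine ((hc _ z hz rfl).1.continuousAt hn).congr ?_
  filter_upwards [hn] with w hw
  rw [connectedComponentIn_eq hw]

/-- Along `a + R e^{it}`, the logarithm minus `it` would be a continuous logarithm of the constant
`R`, hence constant in `t`; yet one full turn changes it by `-2πi`. -/
theorem not_hasLog_sphere (a : ℂ) {R : ℝ} (hR : 0 < R) : ¬ HasLog (Metric.sphere a R) a := by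
  rintro ⟨ψ, hc, hψ⟩
  have hmem : ∀ t : ℝ, circleMap a R t ∈ Metric.sphere a R := fun t =>
    circleMap_mem_sphere a hR.le t
  have hcont : Continuous fun t : ℝ => ψ (circleMap a R t) - t * Complex.I :=
    (hc.comp_continuous (continuous_circleMap a R) hmem).sub (by fun_prop)
  have hexp : ∀ t : ℝ, Complex.exp (ψ (circleMap a R t) - t * Complex.I) = R := fun t => by
    rw [Complex.exp_sub, hψ _ (hmem t), circleMap, add_sub_cancel_left,
      mul_div_cancel_right₀ _ (Complex.exp_ne_zero _)]
  have hconst : ∀ t s : ℝ, ψ (circleMap a R t) - t * Complex.I =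
      ψ (circleMap a R s) - s * Complex.I := by
    have hdisc : ∀ t : ℝ, ∃ n : ℤ, ψ (circleMap a R t) - t * Complex.I =
        Complex.log R + n * (2 * Real.pi * Complex.I) := fun t => by
      refine Complex.exp_eq_exp_iff_exists_int.1 ?_
      rw [hexp t, Complex.exp_log (by exact_mod_cast hR.ne')]
    choose n hn using hdisc
    have hpi : (2 * Real.pi * Complex.I : ℂ) ≠ 0 := Complex.two_pi_I_ne_zero
    have hnc : Continuous fun t : ℝ => ((n t : ℤ) : ℂ) := by
      have : (fun t : ℝ => ((n t : ℤ) : ℂ)) = fun t => (ψ (circleMap a R t) - t * Complex.I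
          - Complex.log R) / (2 * Real.pi * Complex.I) := by
        funext t
        rw [hn t]
        field_simp
        ring
      rw [this]
      fun_prop
    have hnc' : Continuous n := by
      refine continuous_iff_continuousAt.2 fun t => ?_
      have := Int.isClosedEmbedding_coe_real.isInducing
      have h2 : Continuous fun t => ((n t : ℤ) : ℝ) := by
        simpa [Function.comp_def] using Complex.continuous_re.comp hnc
      exact (this.continuous_iff.2 h2).continuousAt
    intro t s
    rw [hn t, hn s, PreconnectedSpace.constant inferInstance hnc']
  have h := hconst 0 (2 * Real.pi)
  have hper : circleMap a R (2 * Real.pi) = circleMap a R 0 := by simp [circleMap]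
  rw [hper] at h
  simp only [Complex.ofReal_zero, zero_mul, sub_zero] at h
  refine Complex.two_pi_I_ne_zero ?_
  push_cast at h
  linear_combination h

/-- If the component `V` of `a` were bounded, `z - a` could be replaced on `V` by the exponential of
a continuous extension of its logarithm. The result has no zero in the plane, so it has a global
logarithm, and this is a logarithm of `z - a` on a large circle around `V`. -/
theorem HasLog.not_isBounded_connectedComponentIn {X : Set ℂ} (hX : IsCompact X) {a : ℂ}
    (h : HasLog X a) : ¬ Bornology.IsBounded (connectedComponentIn Xᶜ a) := by
  classical
  intro hb
  have haX := h.notMem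
  obtain ⟨φ, hc, hφ⟩ := h
  set V := connectedComponentIn Xᶜ a with hV
  have hVo : IsOpen V := hX.isClosed.isOpen_compl.connectedComponentIn
  have haV : a ∈ V := mem_connectedComponentIn haX
  -- On the frontier both pieces of the glued function below must agree, and the logarithm is known
  -- only on `X`.
  have hfr : frontier V ⊆ X := by
    intro z hz
    by_contra hzX
    have hzV : z ∉ V := fun hzV => by
      rw [hVo.frontier_eq] at hz
      exact hz.2 hzV
    have hW : connectedComponentIn Xᶜ z ∈ 𝓝 z :=
      hX.isClosed.isOpen_compl.connectedComponentIn.mem_nhds (mem_connectedComponentIn hzX)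
    obtain ⟨w, hw1, hw2⟩ := mem_closure_iff_nhds.1 (frontier_subset_closure hz) _ hW
    apply hzV
    rw [hV, connectedComponentIn_eq hw2, ← connectedComponentIn_eq hw1]
    exact mem_connectedComponentIn hzX
  obtain ⟨Φ, hΦ⟩ := ContinuousMap.exists_restrict_eq hX.isClosed
    (⟨X.domRestrict φ, continuousOn_iff_continuous_domRestrict.1 hc⟩ : C(X, ℂ))
  have hΦ' : ∀ z ∈ X, Φ z = φ z := fun z hz => congr($hΦ ⟨z, hz⟩)
  set F : ℂ → ℂ := V.piecewise (fun z => Complex.exp (Φ z)) (fun z => z - a) with hF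
  have hFc : Continuous F := by
    refine Continuous.piecewise (fun z hz => ?_) (by fun_prop) (by fun_prop)
    rw [hΦ' z (hfr hz), hφ z (hfr hz)]
  have hF0 : ∀ z, F z ≠ 0 := fun z => by
    by_cases hz : z ∈ V
    · rw [hF, Set.piecewise_eq_of_mem _ _ _ hz]
      exact Complex.exp_ne_zero _
    · rw [hF, Set.piecewise_eq_of_notMem _ _ _ hz, sub_ne_zero]
      rintro rfl
      exact hz haV
  have hsc : IsSimplyConnected (Set.univ : Set ℂ) :=
    (Homeomorph.Set.univ ℂ).toHomotopyEquiv.simplyConnectedSpace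
  obtain ⟨ψ, hψc, hψ⟩ := Complex.exists_continuousOn_eqOn_exp_comp hsc isOpen_univ
    hFc.continuousOn (by rintro ⟨z, -, hz⟩; exact hF0 z hz)
  obtain ⟨R, hR⟩ := hb.subset_ball a
  have hR' : V ⊆ Metric.ball a (max R 1) := hR.trans (Metric.ball_subset_ball (le_max_left _ _))
  refine not_hasLog_sphere a (R := max R 1) (by positivity) ⟨ψ, hψc.mono (Set.subset_univ _),
    fun z hz => ?_⟩
  have hzV : z ∉ V := fun hzV => by
    have := hR' hzV
    rw [Metric.mem_ball] at this
    exact this.ne (Metric.mem_sphere.1 hz)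
  have := hψ (Set.mem_univ z)
  rw [hF, Set.piecewise_eq_of_notMem _ _ _ hzV] at this
  exact this

/-! ### The `∂̄`-derivative and the Cauchy–Pompeiu formula -/

/-- Twice `i` times the `∂̄`-derivative of `u`. -/
def dbar (u : ℂ → ℂ) (w : ℂ) : ℂ :=
  Complex.I * fderiv ℝ u w 1 - fderiv ℝ u w Complex.I

theorem dbar_eq_zero {u : ℂ → ℂ} {w : ℂ} (h : DifferentiableAt ℂ u w) : dbar u w = 0 := by
  rw [dbar, h.fderiv_restrictScalars ℝ]
  simp only [ContinuousLinearMap.coe_restrictScalars']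
  rw [← smul_eq_mul, ← map_smul, smul_eq_mul, mul_one, sub_self]

theorem dbar_mul_of_differentiableAt {u v : ℂ → ℂ} {w : ℂ} (hu : DifferentiableAt ℝ u w)
    (hv : DifferentiableAt ℂ v w) : dbar (fun z => u z * v z) w = dbar u w * v w := by
  have h0 := dbar_eq_zero hv
  have hv' := hv.restrictScalars ℝ
  rw [dbar] at h0
  rw [dbar, dbar, fderiv_fun_mul hu hv']
  simp only [add_apply, smul_apply, smul_eq_mul]
  linear_combination u w * h0

theorem dbar_sub_const (u : ℂ → ℂ) (c w : ℂ) : dbar (fun z => u z - c) w = dbar u w := by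
  rw [dbar, dbar, fderiv_sub_const]

theorem continuous_dbar {u : ℂ → ℂ} (hu : ContDiff ℝ 1 u) : Continuous (dbar u) := by
  have h := hu.continuous_fderiv one_ne_zero
  unfold dbar
  fun_prop

theorem tsupport_dbar_subset (u : ℂ → ℂ) : tsupport (dbar u) ⊆ tsupport u := by
  refine (closure_mono fun w hw => ?_).trans (tsupport_fderiv_subset ℝ)
  rw [Function.mem_support] at hw ⊢
  contrapose! hw
  simp [dbar, hw]

theorem continuous_mul_inv_sub {d : ℂ → ℂ} (hd : Continuous d) {z : ℂ} (hz : z ∉ tsupport d) :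
    Continuous fun w => d w / (w - z) := by
  rw [continuous_iff_continuousAt]
  intro w
  rcases eq_or_ne w z with rfl | hne
  · refine (continuousAt_const (y := (0 : ℂ))).congr ?_
    filter_upwards [notMem_tsupport_iff_eventuallyEq.1 hz] with v hv
    simp [hv]
  · exact hd.continuousAt.div (by fun_prop) (sub_ne_zero.2 hne)

theorem integral_complex_eq_intervalIntegral {G : ℂ → ℂ} (hG : Continuous G)
    (hGc : HasCompactSupport G) {a b c d : ℝ}
    (hsupp : ∀ w, G w ≠ 0 → w.re ∈ Set.Ioc a b ∧ w.im ∈ Set.Ioc c d) :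
    ∫ w, G w = ∫ x in a..b, ∫ y in c..d, G (x + y * Complex.I) := by
  have hint : MeasureTheory.Integrable G := hG.integrable_of_hasCompactSupport hGc
  have e := Complex.volume_preserving_equiv_real_prod.symm
  rw [← e.integral_comp (MeasurableEquiv.measurableEmbedding _), MeasureTheory.Measure.volume_eq_prod,
    MeasureTheory.integral_prod]
  · have h1 : ∀ x : ℝ, ∫ y, G (Complex.measurableEquivRealProd.symm (x, y)) =
        ∫ y in c..d, G (x + y * Complex.I) := fun x => by
      rw [intervalIntegral.integral_eq_integral_of_support_subset]
      · congr 1 with y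
        rw [← Complex.mk_eq_add_mul_I]
        rfl
      · intro y hy
        simpa using (hsupp _ hy).2
    simp_rw [h1]
    rw [intervalIntegral.integral_eq_integral_of_support_subset]
    intro x hx
    rw [Function.mem_support] at hx
    by_contra hx'
    refine hx ?_
    refine (intervalIntegral.integral_congr (g := fun _ => (0 : ℂ)) fun y _ => ?_).trans (by simp)
    by_contra hne
    exact hx' (by simpa using (hsupp _ hne).1)
  · rw [← MeasureTheory.Measure.volume_eq_prod]
    exact (e.integrable_comp_emb (MeasurableEquiv.measurableEmbedding _)).2 hint

/-- Opposite sides of the square combine into integrals of `2T / (s² + T²)`, which are positive.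
Only nonvanishing and independence of `z` matter, so the value is not computed. -/
theorem rect_boundary_integral_inv {T : ℝ} (hT : 0 < T) :
    ∃ c : ℂ, c ≠ 0 ∧ ∀ z : ℂ,
    (∫ x : ℝ in z.re - T..z.re + T, (x + (z.im - T : ℝ) * Complex.I - z)⁻¹) -
      (∫ x : ℝ in z.re - T..z.re + T, (x + (z.im + T : ℝ) * Complex.I - z)⁻¹) +
      Complex.I * (∫ y : ℝ in z.im - T..z.im + T, ((z.re + T : ℝ) + y * Complex.I - z)⁻¹) -
      Complex.I * (∫ y : ℝ in z.im - T..z.im + T, ((z.re - T : ℝ) + y * Complex.I - z)⁻¹) = c := by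
  have key : ∀ s : ℝ, (s : ℂ) ^ 2 + T ^ 2 ≠ 0 := fun s => by
    have : (0 : ℝ) < s ^ 2 + T ^ 2 := by positivity
    exact_mod_cast this.ne'
  have kI := Complex.I_sq
  have f1 : ∀ s : ℝ, (s + T * Complex.I : ℂ) * (s - T * Complex.I) = s ^ 2 + T ^ 2 := fun s => by
    linear_combination (-(T : ℂ) ^ 2) * kI
  have n1 : ∀ s : ℝ, (s + T * Complex.I : ℂ) ≠ 0 := fun s => left_ne_zero_of_mul (f1 s ▸ key s)
  have n2 : ∀ s : ℝ, (s - T * Complex.I : ℂ) ≠ 0 := fun s => right_ne_zero_of_mul (f1 s ▸ key s)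
  have f2 : ∀ s : ℝ, (T + s * Complex.I : ℂ) * (-T + s * Complex.I) = -(s ^ 2 + T ^ 2) := fun s => by
    linear_combination ((s : ℂ) ^ 2) * kI
  have n3 : ∀ s : ℝ, (T + s * Complex.I : ℂ) ≠ 0 := fun s =>
    left_ne_zero_of_mul (f2 s ▸ neg_ne_zero.2 (key s))
  have n4 : ∀ s : ℝ, (-T + s * Complex.I : ℂ) ≠ 0 := fun s =>
    right_ne_zero_of_mul (f2 s ▸ neg_ne_zero.2 (key s))
  have hJ : 0 < ∫ s : ℝ in -T..T, 2 * T / (s ^ 2 + T ^ 2) := by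
    refine intervalIntegral.intervalIntegral_pos_of_pos_on ?_ (fun s _ => by positivity)
      (by linarith)
    refine Continuous.intervalIntegrable ?_ _ _
    exact continuous_const.div (by fun_prop) fun s => by positivity
  refine ⟨2 * Complex.I * ((∫ s : ℝ in -T..T, 2 * T / (s ^ 2 + T ^ 2) : ℝ) : ℂ),
    mul_ne_zero (mul_ne_zero two_ne_zero Complex.I_ne_zero) (by exact_mod_cast hJ.ne'),
    fun z => ?_⟩
  have c1 : (∫ x : ℝ in z.re - T..z.re + T, (x + (z.im - T : ℝ) * Complex.I - z)⁻¹) =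
      ∫ s : ℝ in -T..T, ((s - T * Complex.I : ℂ))⁻¹ := by
    have := intervalIntegral.integral_comp_sub_right (a := z.re - T) (b := z.re + T)
      (fun s : ℝ => ((s - T * Complex.I : ℂ))⁻¹) z.re
    rw [sub_sub_cancel_left, add_sub_cancel_left] at this
    rw [← this]
    congr 1 with x
    congr 1
    apply Complex.ext <;> simp
  have c2 : (∫ x : ℝ in z.re - T..z.re + T, (x + (z.im + T : ℝ) * Complex.I - z)⁻¹) =
      ∫ s : ℝ in -T..T, ((s + T * Complex.I : ℂ))⁻¹ := by
    have := intervalIntegral.integral_comp_sub_right (a := z.re - T) (b := z.re + T)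
      (fun s : ℝ => ((s + T * Complex.I : ℂ))⁻¹) z.re
    rw [sub_sub_cancel_left, add_sub_cancel_left] at this
    rw [← this]
    congr 1 with x
    congr 1
    apply Complex.ext <;> simp
  have c3 : (∫ y : ℝ in z.im - T..z.im + T, ((z.re + T : ℝ) + y * Complex.I - z)⁻¹) =
      ∫ s : ℝ in -T..T, ((T + s * Complex.I : ℂ))⁻¹ := by
    have := intervalIntegral.integral_comp_sub_right (a := z.im - T) (b := z.im + T)
      (fun s : ℝ => ((T + s * Complex.I : ℂ))⁻¹) z.im
    rw [sub_sub_cancel_left, add_sub_cancel_left] at this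
    rw [← this]
    congr 1 with x
    congr 1
    apply Complex.ext <;> simp
  have c4 : (∫ y : ℝ in z.im - T..z.im + T, ((z.re - T : ℝ) + y * Complex.I - z)⁻¹) =
      ∫ s : ℝ in -T..T, ((-T + s * Complex.I : ℂ))⁻¹ := by
    have := intervalIntegral.integral_comp_sub_right (a := z.im - T) (b := z.im + T)
      (fun s : ℝ => ((-T + s * Complex.I : ℂ))⁻¹) z.im
    rw [sub_sub_cancel_left, add_sub_cancel_left] at this
    rw [← this]
    congr 1 with x
    congr 1
    apply Complex.ext <;> simp
  have i1 : IntervalIntegrable (fun s : ℝ => ((s - T * Complex.I : ℂ))⁻¹)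
      MeasureTheory.volume (-T) T :=
    (Continuous.inv₀ (by fun_prop) n2).intervalIntegrable _ _
  have i2 : IntervalIntegrable (fun s : ℝ => ((s + T * Complex.I : ℂ))⁻¹)
      MeasureTheory.volume (-T) T :=
    (Continuous.inv₀ (by fun_prop) n1).intervalIntegrable _ _
  have i3 : IntervalIntegrable (fun s : ℝ => ((T + s * Complex.I : ℂ))⁻¹)
      MeasureTheory.volume (-T) T :=
    (Continuous.inv₀ (by fun_prop) n3).intervalIntegrable _ _
  have i4 : IntervalIntegrable (fun s : ℝ => ((-T + s * Complex.I : ℂ))⁻¹)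
      MeasureTheory.volume (-T) T :=
    (Continuous.inv₀ (by fun_prop) n4).intervalIntegrable _ _
  rw [c1, c2, c3, c4, add_sub_assoc, ← mul_sub, ← intervalIntegral.integral_sub i1 i2,
    ← intervalIntegral.integral_sub i3 i4, ← intervalIntegral.integral_ofReal, two_mul, add_mul]
  congr 1
  · rw [← intervalIntegral.integral_const_mul]
    refine intervalIntegral.integral_congr fun s _ => ?_
    push_cast
    rw [inv_sub_inv (n2 s) (n1 s), mul_comm (_ - _ : ℂ) (_ + _), f1 s]
    ring
  · refine congrArg _ (intervalIntegral.integral_congr fun s _ => ?_)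
    push_cast
    rw [inv_sub_inv (n3 s) (n4 s), f2 s]
    have := key s
    field_simp
    ring

/-- A form of the **Cauchy–Pompeiu formula** for functions with compact support. -/
theorem exists_integral_dbar_div_sub {X : Set ℂ} (hX : Bornology.IsBounded X) {u : ℂ → ℂ}
    (hu : ContDiff ℝ 1 u) (hs : HasCompactSupport u) :
    ∃ c : ℂ, c ≠ 0 ∧ ∀ z ∈ X, z ∉ tsupport (dbar u) → DifferentiableAt ℂ u z →
      ∫ w, dbar u w / (w - z) = c * u z := by
  obtain ⟨R, hR⟩ := (hX.union hs.isCompact.isBounded).exists_norm_le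
  -- Points of `X` and of the support of `u` are at distance at most `2 |R|`, so `u` vanishes on the
  -- boundary of the square of half-side `T` about any `z ∈ X`.
  set T : ℝ := 2 * |R| + 1 with hTdef
  have hT : 0 < T := by positivity
  obtain ⟨c, hc0, hc⟩ := rect_boundary_integral_inv hT
  refine ⟨-c, neg_ne_zero.2 hc0, fun z hz hzd hzu => ?_⟩
  have hfar : ∀ w, u w ≠ 0 → |w.re - z.re| < T ∧ |w.im - z.im| < T := fun w hw => by
    have h1 := hR w (Or.inr (subset_tsupport _ hw))
    have h2 := hR z (Or.inl hz)
    have h3 : ‖w - z‖ < T := by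
      have := norm_sub_le w z
      linarith [le_abs_self R]
    exact ⟨(Complex.abs_re_le_norm (w - z)).trans_lt h3,
      (Complex.abs_im_le_norm (w - z)).trans_lt h3⟩
  have hfar' : ∀ w, dbar u w ≠ 0 → |w.re - z.re| ≤ 2 * |R| ∧ |w.im - z.im| ≤ 2 * |R| :=
      fun w hw => by
    have h1 := hR w (Or.inr (tsupport_dbar_subset u (subset_tsupport _ hw)))
    have h2 := hR z (Or.inl hz)
    have h3 : ‖w - z‖ ≤ 2 * |R| := by
      have := norm_sub_le w z
      linarith [le_abs_self R]
    exact ⟨(Complex.abs_re_le_norm (w - z)).trans h3,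
      (Complex.abs_im_le_norm (w - z)).trans h3⟩
  set G : ℂ → ℂ := fun w => dbar u w / (w - z) with hG
  have hGcont : Continuous G := continuous_mul_inv_sub (continuous_dbar hu) hzd
  have hGsupp : HasCompactSupport G := by
    refine HasCompactSupport.mono (f := dbar u) ?_ fun w hw h0 => hw (by simp [hG, h0])
    exact hs.isCompact.of_isClosed_subset (isClosed_tsupport _) (tsupport_dbar_subset u)
  have hGint := hGcont.integrable_of_hasCompactSupport hGsupp (μ := MeasureTheory.volume)
  -- Green's formula is applied to `(u w - u z) / (w - z)`: it is continuous at `z`, its `dbar`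
  -- elsewhere is the Cauchy integrand, and on the boundary it equals `-u z / (w - z)`.
  have hFd : ∀ w, w ≠ z → HasFDerivAt (dslope u z) (fderiv ℝ (dslope u z) w) w ∧
      dbar (dslope u z) w = G w := fun w hw => by
    have he : dslope u z =ᶠ[𝓝 w] fun v => (u v - u z) * (v - z)⁻¹ := by
      filter_upwards [eventually_ne_nhds hw] with v hv
      rw [dslope_of_ne _ hv, slope_def_field, div_eq_mul_inv]
    have hd1 : DifferentiableAt ℝ (fun v => u v - u z) w :=
      ((hu.differentiable one_ne_zero) w).sub_const _
    have hd2 : DifferentiableAt ℂ (fun v : ℂ => (v - z)⁻¹) w :=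
      (differentiableAt_id.sub_const z).inv (sub_ne_zero.2 hw)
    refine ⟨((hd1.mul (hd2.restrictScalars ℝ)).congr_of_eventuallyEq he).hasFDerivAt, ?_⟩
    have : dbar (dslope u z) w = dbar (fun v => (u v - u z) * (v - z)⁻¹) w := by
      rw [dbar, dbar, he.fderiv_eq]
    rw [this, dbar_mul_of_differentiableAt hd1 hd2, dbar_sub_const, ← div_eq_mul_inv]
  have hFc : Continuous (dslope u z) := by
    rw [continuous_iff_continuousAt]
    intro w
    rcases eq_or_ne w z with rfl | hw
    · exact continuousAt_dslope_same.2 hzu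
    · exact (hFd w hw).1.continuousAt
  have hrect := Complex.integral_boundary_rect_of_hasFDerivAt_real_off_countable (dslope u z)
    (fun w => fderiv ℝ (dslope u z) w) ⟨z.re - T, z.im - T⟩ ⟨z.re + T, z.im + T⟩ {z}
    (Set.countable_singleton z) hFc.continuousOn (fun w hw => (hFd w hw.2).1) (by
      refine (hGint.congr ?_).integrableOn
      have : ∀ᵐ w : ℂ, w ≠ z := by simp [MeasureTheory.ae_iff]
      filter_upwards [this] with w hw
      exact (hFd w hw).2.symm)
  have hrhs : (∫ x : ℝ in z.re - T..z.re + T, ∫ y : ℝ in z.im - T..z.im + T,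
      Complex.I • fderiv ℝ (dslope u z) (x + y * Complex.I) 1 -
        fderiv ℝ (dslope u z) (x + y * Complex.I) Complex.I) = ∫ w, G w := by
    rw [integral_complex_eq_intervalIntegral hGcont hGsupp (a := z.re - T) (b := z.re + T)
      (c := z.im - T) (d := z.im + T)]
    · refine intervalIntegral.integral_congr_ae ?_
      have hx : ∀ᵐ x : ℝ, x ≠ z.re := by simp [MeasureTheory.ae_iff]
      filter_upwards [hx] with x hx _
      congr 1 with y
      refine (hFd _ fun h => hx ?_).2
      simpa using congrArg Complex.re h
    · intro w hw
      have := hfar' w (fun h0 => hw (by simp [hG, h0]))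
      rw [abs_le, abs_le] at this
      refine ⟨⟨?_, ?_⟩, ?_, ?_⟩ <;> linarith [this.1.1, this.1.2, this.2.1, this.2.2]
  have hbd : ∀ w, (T ≤ |w.re - z.re| ∨ T ≤ |w.im - z.im|) →
      dslope u z w = (w - z)⁻¹ * -u z := fun w hw => by
    have hwz : w ≠ z := by
      rintro rfl
      simp at hw
      linarith
    have hw0 : u w = 0 := by
      by_contra h
      have := hfar w h
      rcases hw with hw | hw
      · exact absurd this.1 (not_lt.2 hw)
      · exact absurd this.2 (not_lt.2 hw)
    rw [dslope_of_ne _ hwz, slope_def_field, hw0]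
    ring
  have e1 : ∀ x : ℝ, dslope u z (x + (z.im - T : ℝ) * Complex.I) =
      (x + (z.im - T : ℝ) * Complex.I - z)⁻¹ * -u z := fun x => by
    refine hbd _ (Or.inr ?_)
    simp [abs_of_pos hT]
  have e2 : ∀ x : ℝ, dslope u z (x + (z.im + T : ℝ) * Complex.I) =
      (x + (z.im + T : ℝ) * Complex.I - z)⁻¹ * -u z := fun x => by
    refine hbd _ (Or.inr ?_)
    simp [abs_of_pos hT]
  have e3 : ∀ y : ℝ, dslope u z ((z.re + T : ℝ) + y * Complex.I) =
      ((z.re + T : ℝ) + y * Complex.I - z)⁻¹ * -u z := fun x => by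
    refine hbd _ (Or.inl ?_)
    simp [abs_of_pos hT]
  have e4 : ∀ y : ℝ, dslope u z ((z.re - T : ℝ) + y * Complex.I) =
      ((z.re - T : ℝ) + y * Complex.I - z)⁻¹ * -u z := fun x => by
    refine hbd _ (Or.inl ?_)
    simp [abs_of_pos hT]
  replace hrect := hrect.trans hrhs
  simp only [e1, e2, e3, e4, intervalIntegral.integral_mul_const, smul_eq_mul] at hrect
  rw [← hrect, ← hc z]
  ring

/-! ### Runge approximation -/

/-- The Cauchy–Pompeiu integral of `u` is taken in the closed subalgebra of `C(X, ℂ)` generated by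
the coordinate function, so its value is a uniform limit of polynomials. -/
theorem exists_polynomial_near_of_hasLog {X : Set ℂ} (hX : IsCompact X) {u : ℂ → ℂ}
    (hu : ContDiff ℝ 1 u) (hs : HasCompactSupport u) (hd : ∀ z ∈ X, DifferentiableAt ℂ u z)
    (hlog : ∀ w ∈ tsupport (dbar u), HasLog X w) {ε : ℝ} (hε : 0 < ε) :
    ∃ P : ℂ[X], ∀ z ∈ X, ‖P.eval z - u z‖ < ε := by
  have : CompactSpace X := isCompact_iff_compactSpace.1 hX
  obtain ⟨c, hc0, hc⟩ := exists_integral_dbar_div_sub hX.isBounded hu hs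
  let ι : C(X, ℂ) := ⟨Subtype.val, continuous_subtype_val⟩
  let S := Algebra.elemental ℂ ι
  let x : S := ⟨ι, Algebra.elemental.self_mem ℂ ι⟩
  have hspec : spectrum ℂ (x : C(X, ℂ)) = X := by
    rw [ContinuousMap.spectrum_eq_range]
    exact Subtype.range_coe
  -- Passing to a closed subalgebra can enlarge the spectrum only by bounded components of its
  -- complement, and the logarithm excludes these.
  have hres : ∀ w ∈ tsupport (dbar u), w ∈ resolventSet ℂ x := fun w hw => by
    by_contra hw'
    have hb := Subalgebra.spectrum_isBounded_connectedComponentIn S x (z := w) hw'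
    rw [hspec] at hb
    exact (hlog w hw).not_isBounded_connectedComponentIn hX hb
  let Φ : ℂ → S := fun w => dbar u w • resolvent x w
  have hΦc : Continuous Φ := by
    rw [continuous_iff_continuousAt]
    intro w
    by_cases hw : w ∈ tsupport (dbar u)
    · exact (continuous_dbar hu).continuousAt.smul
        (spectrum.hasDerivAt_resolvent_const_left (hres w hw)).continuousAt
    · refine (continuousAt_const (y := (0 : S))).congr ?_
      filter_upwards [notMem_tsupport_iff_eventuallyEq.1 hw] with v hv
      simp [Φ, hv]
  have hΦs : HasCompactSupport Φ := by
    refine HasCompactSupport.mono (f := dbar u) ?_ fun w hw h0 => hw (by simp [Φ, h0])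
    exact hs.isCompact.of_isClosed_subset (isClosed_tsupport _) (tsupport_dbar_subset u)
  have hΦi : MeasureTheory.Integrable Φ := hΦc.integrable_of_hasCompactSupport hΦs
  let y : S := c⁻¹ • ∫ w, Φ w
  have hy : ∀ z : X, (y : C(X, ℂ)) z = u z := fun z => by
    let E : S →L[ℂ] ℂ := (ContinuousMap.evalCLM ℂ z).comp (Subalgebra.toSubmodule S).subtypeL
    have hE : ∀ s : S, E s = (s : C(X, ℂ)) z := fun s => rfl
    have h1 : E (∫ w, Φ w) = ∫ w, dbar u w / (w - z) := by
      rw [← E.integral_comp_comm hΦi]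
      congr 1 with w
      rw [map_smul, smul_eq_mul, div_eq_mul_inv]
      by_cases hw : w ∈ tsupport (dbar u)
      · congr 1
        have h2 : resolvent x w * (algebraMap ℂ S w - x) = 1 :=
          Ring.inverse_mul_cancel _ (hres w hw)
        have h3 := congrArg E h2
        have h4 : E (resolvent x w) * (w - z) = 1 := h3
        exact eq_inv_of_mul_eq_one_left h4
      · rw [image_eq_zero_of_notMem_tsupport hw, zero_mul, zero_mul]
    have h2 : (y : C(X, ℂ)) z = c⁻¹ * E (∫ w, Φ w) := by
      rw [← hE, map_smul, smul_eq_mul]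
    rw [h2, h1, hc z z.2 (fun hz => (hlog z hz).notMem z.2) (hd z z.2), inv_mul_cancel_left₀ hc0]
  have hmem : (y : C(X, ℂ)) ∈ closure (Algebra.adjoin ℂ {ι} : Set C(X, ℂ)) := y.2
  obtain ⟨v, hv, hvε⟩ := Metric.mem_closure_iff.1 hmem ε hε
  rw [Algebra.adjoin_singleton_eq_range_aeval] at hv
  obtain ⟨P, rfl⟩ := hv
  refine ⟨P, fun z hz => ?_⟩
  have h1 := (ContinuousMap.dist_lt_iff hε).1 hvε ⟨z, hz⟩
  rw [hy, dist_comm, dist_eq_norm] at h1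
  have h2 : (aeval ι P : C(X, ℂ)) ⟨z, hz⟩ = P.eval z := by
    have := Polynomial.aeval_algHom_apply (ContinuousMap.evalAlgHom ℂ ℂ (⟨z, hz⟩ : X)) ι P
    rw [← Polynomial.coe_aeval_eq_eval]
    exact this.symm
  exact h2 ▸ h1

/-- A form of **Runge's theorem**: simultaneous approximation by polynomials of a holomorphic
function on a compact subset of a simply connected open set `Ω`, and of a polynomial on a compact
set with connected complement outside `Ω`. -/
theorem IsSimplyConnectedOpen.exists_polynomial_near {Ω : Set ℂ} (hΩ : IsSimplyConnectedOpen Ω)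
    {M K : Set ℂ} (hM : IsCompact M) (hMΩ : M ⊆ Ω) (hK : IsCompact K) (hKΩ : K ⊆ Ωᶜ)
    (hKc : IsPreconnected Kᶜ) {g : ℂ → ℂ} (hg : DifferentiableOn ℂ g Ω) (h : ℂ[X])
    {ε : ℝ} (hε : 0 < ε) :
    ∃ P : ℂ[X], (∀ z ∈ M, ‖P.eval z - g z‖ < ε) ∧ ∀ z ∈ K, ‖P.eval z - h.eval z‖ < ε := by
  -- `H` plays the role of `M` with the holes filled; `Ω` having no holes keeps it inside `Ω`.
  set H : Set ℂ := {a | HasLog M a}ᶜ with hH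
  have hHclosed : IsClosed H := (isOpen_setOf_hasLog hM.isClosed).isClosed_compl
  have hHb : Bornology.IsBounded H := by
    obtain ⟨R, hR⟩ := hM.isBounded.exists_norm_le
    refine (Metric.isBounded_closedBall (x := (0 : ℂ)) (r := R)).subset fun a ha => ?_
    rw [mem_closedBall_zero_iff]
    by_contra! hlt
    exact ha (HasLog.of_norm_lt fun z hz => (hR z hz).trans_lt hlt)
  have hHc : IsCompact H := Metric.isCompact_of_isClosed_isBounded hHclosed hHb
  have hMH : M ⊆ H := fun z hz hl => hl.notMem hz
  have hHΩ : H ⊆ Ω := fun z hz => by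
    by_contra hzΩ
    exact hz ((hΩ.hasLog hzΩ).mono hMΩ)
  obtain ⟨t, ht, hHt, htΩ⟩ := exists_compact_between hHc hΩ.1 hHΩ
  obtain ⟨χ, hχ1, hχ0, -⟩ :=
    exists_contMDiffMap_one_nhds_of_subset_interior (modelWithCornersSelf ℝ ℂ) (n := 1) hHclosed hHt
  have hχ : ContDiff ℝ 1 χ := χ.contMDiff.contDiff
  -- Subtracting `h` turns the target on `K` into `0`, which the cut-off function has near `K`; `h`
  -- is added back at the end.
  set v : ℂ → ℂ := fun w => g w - h.eval w with hv
  have hvd : DifferentiableOn ℂ v Ω := hg.sub h.differentiable.differentiableOn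
  set u : ℂ → ℂ := fun w => (χ w : ℂ) * v w with hu
  have hut : ∀ w ∉ t, u =ᶠ[𝓝 w] fun _ => 0 := fun w hw => by
    filter_upwards [ht.isClosed.isOpen_compl.mem_nhds hw] with y hy
    simp [hu, hχ0 y hy]
  have huH : ∀ w ∈ H, u =ᶠ[𝓝 w] v := fun w hw => by
    filter_upwards [eventually_nhdsSet_iff_forall.1 hχ1 w hw] with y hy
    simp [hu, hy]
  have hvat : ∀ w ∈ Ω, DifferentiableAt ℂ v w := fun w hw =>
    hvd.differentiableAt (hΩ.1.mem_nhds hw)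
  have huc : ContDiff ℝ 1 u := by
    rw [contDiff_iff_contDiffAt]
    intro w
    by_cases hw : w ∈ t
    · have h1 : ContDiffAt ℂ 1 v w := (hvd.contDiffOn hΩ.1).contDiffAt (hΩ.1.mem_nhds (htΩ hw))
      exact (Complex.ofRealCLM.contDiff.comp hχ).contDiffAt.mul (h1.restrict_scalars ℝ)
    · exact contDiffAt_const.congr_of_eventuallyEq (hut w hw)
  have hus : HasCompactSupport u := HasCompactSupport.intro ht fun w hw => (hut w hw).eq_of_nhds
  have hKt : ∀ w ∈ K, w ∉ t := fun w hw hwt => hKΩ hw (htΩ hwt)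
  have hdisj : Disjoint M K := Set.disjoint_left.2 fun z hz hzK => hKΩ hzK (hMΩ hz)
  have hd : ∀ z ∈ M ∪ K, DifferentiableAt ℂ u z := by
    rintro z (hz | hz)
    · exact (hvat z (hMΩ hz)).congr_of_eventuallyEq (huH z (hMH hz))
    · exact (differentiableAt_const _).congr_of_eventuallyEq (hut z (hKt z hz))
  -- `u` is holomorphic near `H` and supported in `t`, so a pole `w` avoids `H`, giving a logarithm
  -- on `M`, and avoids `K`, giving one on `K`.
  have hlog : ∀ w ∈ tsupport (dbar u), HasLog (M ∪ K) w := by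
    intro w hw
    refine HasLog.union hM.isClosed hK.isClosed hdisj ?_
      (hasLog_of_isConnected_compl hK hKc fun hwK => hKt w hwK
        ((ht.isClosed.closure_subset_iff.2 fun y hy => ?_) (tsupport_dbar_subset u hw)))
    · by_contra hwH
      refine notMem_tsupport_iff_eventuallyEq.2 ?_ hw
      filter_upwards [(huH w hwH).eventually_nhds, hΩ.1.mem_nhds (hHΩ hwH)] with y hy hyΩ
      exact dbar_eq_zero ((hvat y hyΩ).congr_of_eventuallyEq hy)
    · by_contra hyt
      exact hy (hut y hyt).eq_of_nhds

  obtain ⟨P, hP⟩ := exists_polynomial_near_of_hasLog (hM.union hK) huc hus hd hlog hε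
  refine ⟨P + h, fun z hz => ?_, fun z hz => ?_⟩
  · have := hP z (Or.inl hz)
    rw [(huH z (hMH hz)).eq_of_nhds, hv] at this
    convert this using 2
    rw [eval_add]
    ring
  · have := hP z (Or.inr hz)
    rw [(hut z (hKt z hz)).eq_of_nhds] at this
    convert this using 2
    rw [eval_add]
    ring

/-! ### Algebra of Padé approximants -/

/-- The Taylor series of `f` at `ζ`, as a formal power series. -/
def taylorPowerSeries (f : ℂ → ℂ) (ζ : ℂ) : PowerSeries ℂ :=
  PowerSeries.mk (taylorCoeff f ζ)

@[simp]
theorem coeff_taylorPowerSeries (f : ℂ → ℂ) (ζ : ℂ) (n : ℕ) :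
    PowerSeries.coeff n (taylorPowerSeries f ζ) = taylorCoeff f ζ n :=
  PowerSeries.coeff_mk _ _

theorem taylorCoeff_congr {f g : ℂ → ℂ} {ζ : ℂ} (h : f =ᶠ[𝓝 ζ] g) (n : ℕ) :
    taylorCoeff f ζ n = taylorCoeff g ζ n := by
  rw [taylorCoeff, taylorCoeff, h.iteratedDeriv_eq]

theorem taylorPowerSeries_congr {f g : ℂ → ℂ} {ζ : ℂ} (h : f =ᶠ[𝓝 ζ] g) :
    taylorPowerSeries f ζ = taylorPowerSeries g ζ := by
  ext n
  simp [taylorCoeff_congr h]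

theorem taylorPowerSeries_mul {f g : ℂ → ℂ} {ζ : ℂ} (hf : AnalyticAt ℂ f ζ)
    (hg : AnalyticAt ℂ g ζ) :
    taylorPowerSeries (f * g) ζ = taylorPowerSeries f ζ * taylorPowerSeries g ζ := by
  ext n
  simp only [coeff_taylorPowerSeries, taylorCoeff, PowerSeries.coeff_mul,
    iteratedDeriv_mul hf.contDiffAt hg.contDiffAt,
    Finset.Nat.sum_antidiagonal_eq_sum_range_succ_mk, Nat.succ_eq_add_one, Finset.sum_div]
  refine Finset.sum_congr rfl fun i hi => ?_
  rw [Nat.cast_choose _ (by grind)]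
  field_simp [Nat.factorial_ne_zero]

theorem iteratedDeriv_polynomial_eval (P : ℂ[X]) (n : ℕ) :
    iteratedDeriv n (fun z => P.eval z) = fun z => (derivative^[n] P).eval z := by
  induction n with
  | zero => simp
  | succ n ih =>
    rw [iteratedDeriv_succ, ih]
    funext z
    rw [Polynomial.deriv, Function.iterate_succ_apply']

theorem taylorCoeff_polynomial_eval (P : ℂ[X]) (ζ : ℂ) (n : ℕ) :
    taylorCoeff (fun z => P.eval z) ζ n = (taylor ζ P).coeff n := by
  rw [taylorCoeff, iteratedDeriv_polynomial_eval, taylor_coeff, ← factorial_smul_hasseDeriv,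
    LinearMap.smul_apply]
  beta_reduce
  rw [nsmul_eq_mul, eval_mul, eval_natCast, mul_div_cancel_left₀]
  exact_mod_cast n.factorial_ne_zero

theorem taylorPowerSeries_polynomial_eval (P : ℂ[X]) (ζ : ℂ) :
    taylorPowerSeries (fun z => P.eval z) ζ = (taylor ζ P : ℂ[X]) := by
  ext n
  simp [taylorCoeff_polynomial_eval]

/-- The linearized Padé conditions on the numerator and the denominator. -/
structure PadePair (f : ℂ → ℂ) (ζ : ℂ) (p q : ℕ) (A B : ℂ[X]) : Prop where
  natDegree_num_le : A.natDegree ≤ p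
  natDegree_den_le : B.natDegree ≤ q
  den_eval : B.eval ζ = 1
  X_pow_dvd : PowerSeries.X ^ (p + q + 1) ∣
    ((taylor ζ B : ℂ[X]) : PowerSeries ℂ) * taylorPowerSeries f ζ - ((taylor ζ A : ℂ[X]) : PowerSeries ℂ)

theorem isUnit_taylor_of_eval_ne_zero {B : ℂ[X]} {ζ : ℂ} (hB : B.eval ζ ≠ 0) :
    IsUnit ((taylor ζ B : ℂ[X]) : PowerSeries ℂ) := by
  rw [PowerSeries.isUnit_iff_constantCoeff, ← PowerSeries.coeff_zero_eq_constantCoeff_apply,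
    Polynomial.coeff_coe, taylor_coeff_zero]
  exact isUnit_iff_ne_zero.2 hB

/-- As `B(ζ) = 1`, the Taylor series of `B` is a unit, so multiplying by it does not change the
order of vanishing of `f - A / B`. -/
theorem isPade_iff {f : ℂ → ℂ} {ζ : ℂ} {p q : ℕ} {Φ : RatFunc ℂ} :
    IsPade f ζ p q Φ ↔ ∃ A B : ℂ[X], PadePair f ζ p q A B ∧
      Φ = algebraMap ℂ[X] (RatFunc ℂ) A / algebraMap ℂ[X] (RatFunc ℂ) B := by
  have key : ∀ A B : ℂ[X], B.eval ζ = 1 →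
      ((∀ ν ≤ p + q, taylorCoeff (fun z => A.eval z / B.eval z) ζ ν = taylorCoeff f ζ ν) ↔
        PowerSeries.X ^ (p + q + 1) ∣
          ((taylor ζ B : ℂ[X]) : PowerSeries ℂ) * taylorPowerSeries f ζ - ((taylor ζ A : ℂ[X]) : PowerSeries ℂ)) := by
    intro A B hB
    have hB0 : B.eval ζ ≠ 0 := by simp [hB]
    have hA : AnalyticAt ℂ (fun z => A.eval z) ζ := A.differentiable.analyticAt ζ
    have hB' : AnalyticAt ℂ (fun z => B.eval z) ζ := B.differentiable.analyticAt ζ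
    have h1 : taylorPowerSeries (fun z => A.eval z) ζ =
        taylorPowerSeries (fun z => B.eval z) ζ *
          taylorPowerSeries (fun z => A.eval z / B.eval z) ζ := by
      rw [← taylorPowerSeries_mul hB' (hA.fun_div hB' hB0)]
      refine taylorPowerSeries_congr ?_
      filter_upwards [hB'.continuousAt.eventually_ne hB0] with z hz
      exact (mul_div_cancel₀ _ hz).symm
    rw [taylorPowerSeries_polynomial_eval, taylorPowerSeries_polynomial_eval] at h1
    rw [h1, ← mul_sub, (isUnit_taylor_of_eval_ne_zero hB0).dvd_mul_left, PowerSeries.X_pow_dvd_iff]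
    simp only [map_sub, coeff_taylorPowerSeries, sub_eq_zero, Nat.lt_succ_iff]
    exact forall₂_congr fun _ _ => eq_comm
  constructor
  · rintro ⟨A, B, hA, hB, h1, hΦ, h⟩
    exact ⟨A, B, ⟨hA, hB, h1, (key A B h1).1 h⟩, hΦ⟩
  · rintro ⟨A, B, h, hΦ⟩
    exact ⟨A, B, h.1, h.2, h.3, hΦ, (key A B h.3).2 h.4⟩

/-- The coefficients of `B f` of order `p + 1, …, p + q` are the rows of the Hankel system, once the
unknowns `b 1, …, b q` are listed in reverse. -/
theorem sum_antidiagonal_mul_taylorCoeff (f : ℂ → ℂ) (ζ : ℂ) {p q : ℕ} {b : ℕ → ℂ}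
    (hb : ∀ k, q < k → b k = 0) (i : Fin q) :
    ∑ x ∈ Finset.HasAntidiagonal.antidiagonal (p + 1 + i), b x.1 * taylorCoeff f ζ x.2 =
      b 0 * taylorCoeff f ζ (p + 1 + i) + (hankelMatrix f ζ p q).mulVec (fun j => b (q - j)) i := by
  set n : ℕ := p + 1 + i with hn
  -- The range `n + q + 1` contains both natural truncations: beyond `n` the Taylor coefficient has
  -- negative index, beyond `q` the factor `b k` is `0`.
  have h1 : ∑ x ∈ Finset.HasAntidiagonal.antidiagonal n, b x.1 * taylorCoeff f ζ x.2 =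
      ∑ k ∈ Finset.range (n + q + 1), b k * taylorCoeffInt f ζ ((n : ℤ) - k) := by
    rw [Finset.Nat.sum_antidiagonal_eq_sum_range_succ_mk]
    refine Finset.sum_subset_zero_on_sdiff (Finset.range_mono (by omega)) (fun k hk => ?_)
      fun k hk => ?_
    · simp only [Finset.mem_sdiff, Finset.mem_range] at hk
      rw [taylorCoeffInt, if_pos (by omega), mul_zero]
    · simp only [Finset.mem_range] at hk
      rw [taylorCoeffInt, if_neg (by omega)]
      congr 2
      omega
  have h2 : ∑ k ∈ Finset.range (q + 1), b k * taylorCoeffInt f ζ ((n : ℤ) - k) =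
      ∑ k ∈ Finset.range (n + q + 1), b k * taylorCoeffInt f ζ ((n : ℤ) - k) := by
    refine Finset.sum_subset (Finset.range_mono (by omega)) fun k _ hk => ?_
    rw [hb k (by simpa using hk), zero_mul]
  have h3 : taylorCoeffInt f ζ n = taylorCoeff f ζ n := by
    rw [taylorCoeffInt, if_neg (by omega), Int.toNat_natCast]
  rw [h1, ← h2, Finset.sum_range_succ', Nat.cast_zero, sub_zero, h3,
    add_comm (b 0 * taylorCoeff f ζ n), add_left_inj, ← Finset.sum_range_reflect,
    ← Fin.sum_univ_eq_sum_range
      (fun j => b (q - 1 - j + 1) * taylorCoeffInt f ζ ((n : ℤ) - (q - 1 - j + 1 : ℕ)))]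
  simp only [Matrix.mulVec, dotProduct, hankelMatrix, Matrix.of_apply]
  refine Finset.sum_congr rfl fun j _ => ?_
  have := j.2
  rw [mul_comm]
  congr 2 <;> omega

/-- The solution of the linear system that determines the denominator of the Padé approximant. -/
def padeVec (f : ℂ → ℂ) (ζ : ℂ) (p q : ℕ) : Fin q → ℂ :=
  (hankelMatrix f ζ p q)⁻¹.mulVec fun i => -taylorCoeff f ζ (p + 1 + i)

/-- The Taylor coefficients at the center of the denominator of the Padé approximant. -/
def padeDenCoeff (f : ℂ → ℂ) (ζ : ℂ) (p q i : ℕ) : ℂ :=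
  if h : 0 < i ∧ i ≤ q then padeVec f ζ p q ⟨q - i, by omega⟩ else if i = 0 then 1 else 0

/-- The Taylor coefficients at the center of the numerator of the Padé approximant. -/
def padeNumCoeff (f : ℂ → ℂ) (ζ : ℂ) (p q k : ℕ) : ℂ :=
  ∑ x ∈ Finset.HasAntidiagonal.antidiagonal k, padeDenCoeff f ζ p q x.1 * taylorCoeff f ζ x.2

/-- The denominator of the Padé approximant. -/
def padeDen (f : ℂ → ℂ) (ζ : ℂ) (p q : ℕ) : ℂ[X] :=
  taylor (-ζ) (∑ i ∈ Finset.range (q + 1), monomial i (padeDenCoeff f ζ p q i))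

/-- The numerator of the Padé approximant. -/
def padeNum (f : ℂ → ℂ) (ζ : ℂ) (p q : ℕ) : ℂ[X] :=
  taylor (-ζ) (∑ i ∈ Finset.range (p + 1), monomial i (padeNumCoeff f ζ p q i))

theorem coeff_sum_monomial (b : ℕ → ℂ) (m n : ℕ) :
    (∑ i ∈ Finset.range (m + 1), monomial i (b i)).coeff n = if n ≤ m then b n else 0 := by
  simp [coeff_monomial]

theorem natDegree_sum_monomial_le (b : ℕ → ℂ) (m : ℕ) :
    (∑ i ∈ Finset.range (m + 1), monomial i (b i)).natDegree ≤ m :=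
  natDegree_le_iff_coeff_eq_zero.2 fun n hn => by
    rw [coeff_sum_monomial, if_neg (not_le.2 hn)]

theorem taylor_taylor_neg (ζ : ℂ) (P : ℂ[X]) : taylor ζ (taylor (-ζ) P) = P := by
  rw [taylor_taylor, add_neg_cancel, taylor_zero]

theorem coeff_taylor_padeDen (f : ℂ → ℂ) (ζ : ℂ) (p q n : ℕ) :
    (taylor ζ (padeDen f ζ p q)).coeff n = padeDenCoeff f ζ p q n := by
  rw [padeDen, taylor_taylor_neg, coeff_sum_monomial]
  split_ifs with h
  · rfl
  · rw [padeDenCoeff, dif_neg (by omega), if_neg (by omega)]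

theorem coeff_taylor_padeNum (f : ℂ → ℂ) (ζ : ℂ) (p q n : ℕ) :
    (taylor ζ (padeNum f ζ p q)).coeff n = if n ≤ p then padeNumCoeff f ζ p q n else 0 := by
  rw [padeNum, taylor_taylor_neg, coeff_sum_monomial]

theorem InPadeClass.mulVec_eq_iff {f : ℂ → ℂ} {ζ : ℂ} {p q : ℕ} (h : InPadeClass f ζ p q)
    (c : Fin q → ℂ) :
    (hankelMatrix f ζ p q).mulVec c = (fun i : Fin q => -taylorCoeff f ζ (p + 1 + i)) ↔
      c = padeVec f ζ p q := by
  have hu : IsUnit (hankelMatrix f ζ p q).det := isUnit_iff_ne_zero.2 h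
  constructor
  · intro hc
    rw [padeVec, ← hc, Matrix.mulVec_mulVec, Matrix.nonsing_inv_mul _ hu, Matrix.one_mulVec]
  · rintro rfl
    rw [padeVec, Matrix.mulVec_mulVec, Matrix.mul_nonsing_inv _ hu, Matrix.one_mulVec]

/-- Orders up to `p` hold by the choice of the numerator; the remaining `q` orders are the Hankel
equations. -/
theorem InPadeClass.padePair {f : ℂ → ℂ} {ζ : ℂ} {p q : ℕ} (h : InPadeClass f ζ p q) :
    PadePair f ζ p q (padeNum f ζ p q) (padeDen f ζ p q) := by
  refine ⟨?_, ?_, ?_, ?_⟩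
  · rw [padeNum, natDegree_taylor]
    exact natDegree_sum_monomial_le _ _
  · rw [padeDen, natDegree_taylor]
    exact natDegree_sum_monomial_le _ _
  · rw [← taylor_coeff_zero, coeff_taylor_padeDen, padeDenCoeff, dif_neg (by omega), if_pos rfl]
  · rw [PowerSeries.X_pow_dvd_iff]
    intro n hn
    rw [map_sub, PowerSeries.coeff_mul, Polynomial.coeff_coe, coeff_taylor_padeNum]
    simp only [Polynomial.coeff_coe, coeff_taylor_padeDen, coeff_taylorPowerSeries]
    split_ifs with hnp
    · rw [padeNumCoeff, sub_self]
    · obtain ⟨i, rfl⟩ : ∃ i : Fin q, n = p + 1 + i := ⟨⟨n - (p + 1), by omega⟩, by simp; omega⟩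
      rw [sum_antidiagonal_mul_taylorCoeff f ζ (fun k hk => by
        rw [padeDenCoeff, dif_neg (by omega), if_neg (by omega)])]
      have hv : (fun j : Fin q => padeDenCoeff f ζ p q (q - j)) = padeVec f ζ p q := by
        funext j
        have := j.2
        rw [padeDenCoeff, dif_pos (by omega)]
        congr 1
        apply Fin.ext
        simp only
        omega
      rw [hv, (h.mulVec_eq_iff _).2 rfl, padeDenCoeff, dif_neg (by omega), if_pos rfl]
      ring

theorem InPadeClass.eq_of_padePair {f : ℂ → ℂ} {ζ : ℂ} {p q : ℕ} (h : InPadeClass f ζ p q)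
    {A B : ℂ[X]} (hAB : PadePair f ζ p q A B) : A = padeNum f ζ p q ∧ B = padeDen f ζ p q := by
  obtain ⟨hA, hB, h1, hd⟩ := hAB
  have hA' : ∀ n, p < n → (taylor ζ A).coeff n = 0 := fun n hn =>
    coeff_eq_zero_of_natDegree_lt (by rw [natDegree_taylor]; omega)
  have hB' : ∀ n, q < n → (taylor ζ B).coeff n = 0 := fun n hn =>
    coeff_eq_zero_of_natDegree_lt (by rw [natDegree_taylor]; omega)
  have hd' : ∀ n < p + q + 1, ∑ x ∈ Finset.HasAntidiagonal.antidiagonal n,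
      (taylor ζ B).coeff x.1 * taylorCoeff f ζ x.2 = (taylor ζ A).coeff n := fun n hn => by
    have := PowerSeries.X_pow_dvd_iff.1 hd n hn
    rw [map_sub, PowerSeries.coeff_mul, sub_eq_zero] at this
    simpa using this
  have h0 : (taylor ζ B).coeff 0 = 1 := by rw [taylor_coeff_zero, h1]
  have hv : (fun j : Fin q => (taylor ζ B).coeff (q - j)) = padeVec f ζ p q := by
    rw [← h.mulVec_eq_iff]
    funext i
    have h2 := sum_antidiagonal_mul_taylorCoeff f ζ (p := p) hB' i
    rw [hd' _ (by omega), hA' _ (by omega), h0] at h2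
    linear_combination -h2
  have hBc : ∀ n, (taylor ζ B).coeff n = padeDenCoeff f ζ p q n := fun n => by
    rw [padeDenCoeff]
    split_ifs with hn hn0
    · rw [← hv]
      congr 1
      simp only
      omega
    · rw [hn0, h0]
    · exact hB' n (by omega)
  constructor
  · refine taylor_injective ζ (Polynomial.ext fun n => ?_)
    rw [coeff_taylor_padeNum]
    split_ifs with hn
    · rw [← hd' n (by omega), padeNumCoeff]
      simp only [hBc]
    · exact hA' n (by omega)
  · refine taylor_injective ζ (Polynomial.ext fun n => ?_)
    rw [coeff_taylor_padeDen, hBc]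

theorem InPadeClass.pade_eq {f : ℂ → ℂ} {ζ : ℂ} {p q : ℕ} (h : InPadeClass f ζ p q) :
    pade f ζ p q = algebraMap ℂ[X] (RatFunc ℂ) (padeNum f ζ p q) /
      algebraMap ℂ[X] (RatFunc ℂ) (padeDen f ζ p q) := by
  have hex : ∃ Φ, IsPade f ζ p q Φ := ⟨_, isPade_iff.2 ⟨_, _, h.padePair, rfl⟩⟩
  rw [pade, dif_pos hex]
  obtain ⟨A, B, hAB, hΦ⟩ := isPade_iff.1 hex.choose_spec
  obtain ⟨rfl, rfl⟩ := h.eq_of_padePair hAB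
  exact hΦ

/-- Poles are read off the reduced fraction. A common factor `D` of numerator and denominator has
`D(ζ) ≠ 0`, so cancelling it and rescaling gives another admissible pair, and uniqueness of the
pair, not just of the quotient, identifies the two. -/
theorem InPadeClass.exists_eq_C_mul {f : ℂ → ℂ} {ζ : ℂ} {p q : ℕ} (h : InPadeClass f ζ p q) :
    ∃ c : ℂ, c ≠ 0 ∧ padeNum f ζ p q = C c * (pade f ζ p q).num ∧
      padeDen f ζ p q = C c * (pade f ζ p q).denom := by
  set A := padeNum f ζ p q
  set B := padeDen f ζ p q
  set Φ := pade f ζ p q with hΦ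
  have hp : PadePair f ζ p q A B := h.padePair
  have hB0 : B ≠ 0 := by
    intro h0
    have := hp.den_eval
    simp [h0] at this
  have hΦ' : Φ = algebraMap ℂ[X] (RatFunc ℂ) A / algebraMap ℂ[X] (RatFunc ℂ) B := h.pade_eq
  obtain ⟨D, hD⟩ : Φ.denom ∣ B := hΦ' ▸ RatFunc.denom_div_dvd A B
  have hA : A = Φ.num * D := by
    have h1 := RatFunc.num_div_denom Φ
    have hB1 : algebraMap ℂ[X] (RatFunc ℂ) B ≠ 0 :=
      (map_ne_zero_iff _ (RatFunc.algebraMap_injective ℂ)).2 hB0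
    have hd1 : algebraMap ℂ[X] (RatFunc ℂ) Φ.denom ≠ 0 :=
      (map_ne_zero_iff _ (RatFunc.algebraMap_injective ℂ)).2 Φ.denom_ne_zero
    rw [hΦ', div_eq_div_iff (hΦ' ▸ hd1) hB1, ← map_mul, ← map_mul, ← hΦ'] at h1
    have h2 := RatFunc.algebraMap_injective ℂ h1
    refine mul_right_cancel₀ Φ.denom_ne_zero ?_
    rw [← h2, hD]
    ring
  have hD0 : D ≠ 0 := by
    rintro rfl
    exact hB0 (by rw [hD, mul_zero])
  have hden : D.eval ζ * Φ.denom.eval ζ = 1 := by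
    rw [← hp.den_eval, hD, eval_mul, mul_comm]
  have hDζ : D.eval ζ ≠ 0 := left_ne_zero_of_mul_eq_one hden
  refine ⟨D.eval ζ, hDζ, ?_⟩
  have hpair : PadePair f ζ p q (C (D.eval ζ) * Φ.num) (C (D.eval ζ) * Φ.denom) := by
    refine ⟨?_, ?_, ?_, ?_⟩
    · refine (natDegree_C_mul_le _ _).trans ?_
      rcases eq_or_ne Φ.num 0 with h0 | h0
      · simp [h0]
      · have := hp.natDegree_num_le
        rw [hA, natDegree_mul h0 hD0] at this
        omega
    · refine (natDegree_C_mul_le _ _).trans ?_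
      have := hp.natDegree_den_le
      rw [hD, natDegree_mul Φ.denom_ne_zero hD0] at this
      omega
    · rw [eval_mul, eval_C, hden]
    · have h1 := hp.X_pow_dvd
      rw [hA, hD] at h1
      have h2 : ((taylor ζ (Φ.denom * D) : ℂ[X]) : PowerSeries ℂ) * taylorPowerSeries f ζ -
          ((taylor ζ (Φ.num * D) : ℂ[X]) : PowerSeries ℂ) =
          ((taylor ζ D : ℂ[X]) : PowerSeries ℂ) *
          (((taylor ζ Φ.denom : ℂ[X]) : PowerSeries ℂ) * taylorPowerSeries f ζ -
          ((taylor ζ Φ.num : ℂ[X]) : PowerSeries ℂ)) := by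
        rw [taylor_mul, taylor_mul, Polynomial.coe_mul, Polynomial.coe_mul]
        ring
      rw [h2, (isUnit_taylor_of_eval_ne_zero hDζ).dvd_mul_left] at h1
      rw [taylor_mul, taylor_mul, Polynomial.coe_mul, Polynomial.coe_mul, mul_assoc, ← mul_sub]
      exact h1.mul_left _
  obtain ⟨e1, e2⟩ := h.eq_of_padePair hpair
  exact ⟨e1.symm, e2.symm⟩

theorem InPadeClass.ratFuncDist_pade {f : ℂ → ℂ} {ζ : ℂ} {p q : ℕ} (h : InPadeClass f ζ p q)
    {z : ℂ} (w : ℂ) (hz : (padeDen f ζ p q).eval z ≠ 0) :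
    ratFuncDist (pade f ζ p q) z w =
      ‖(padeNum f ζ p q).eval z / (padeDen f ζ p q).eval z - w‖ₑ := by
  obtain ⟨c, hc, hA, hB⟩ := h.exists_eq_C_mul
  have hd : (pade f ζ p q).denom.eval z ≠ 0 := fun h0 => hz (by rw [hB, eval_mul, h0, mul_zero])
  rw [ratFuncDist, if_neg hd, hA, hB, eval_mul, eval_mul, eval_C, mul_div_mul_left _ _ hc]

theorem InPadeClass.padeDen_eval_ne_zero {f : ℂ → ℂ} {ζ : ℂ} {p q : ℕ} (h : InPadeClass f ζ p q)
    {z w : ℂ} (hz : ratFuncDist (pade f ζ p q) z w ≠ ⊤) : (padeDen f ζ p q).eval z ≠ 0 := by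
  obtain ⟨c, hc, -, hB⟩ := h.exists_eq_C_mul
  rw [hB, eval_mul, eval_C]
  refine mul_ne_zero hc fun h0 => hz ?_
  rw [ratFuncDist, if_pos h0]

/-! ### Approximants of polynomials -/

/-- With columns reversed, entry `(i, j)` is the coefficient of index `deg P + i - j`: zero below
the diagonal, the leading coefficient on it. -/
theorem inPadeClass_of_eventuallyEq_polynomial {f : ℂ → ℂ} {ζ : ℂ} {P : ℂ[X]}
    (hP : P ≠ 0) (hf : f =ᶠ[𝓝 ζ] fun z => P.eval z) (q : ℕ) :
    InPadeClass f ζ P.natDegree q := by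
  have hcoeff : ∀ n, taylorCoeff f ζ n = (taylor ζ P).coeff n := fun n => by
    rw [taylorCoeff_congr hf, taylorCoeff_polynomial_eval]
  set H := hankelMatrix f ζ P.natDegree q
  have htri : (H.submatrix id Fin.revPerm).IsUpperTriangular := by
    intro i j hij
    have hij' : (j : ℕ) < i := hij
    simp only [H, Matrix.submatrix_apply, hankelMatrix, Matrix.of_apply, id, Fin.revPerm_apply,
      Fin.val_rev]
    rw [taylorCoeffInt, if_neg (by omega), hcoeff, coeff_eq_zero_of_natDegree_lt]
    rw [natDegree_taylor]
    omega
  have hdet : (H.submatrix id Fin.revPerm).det ≠ 0 := by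
    rw [Matrix.det_of_isUpperTriangular htri, Finset.prod_ne_zero_iff]
    intro i _
    simp only [H, Matrix.submatrix_apply, hankelMatrix, Matrix.of_apply, id, Fin.revPerm_apply,
      Fin.val_rev]
    have hidx : ((P.natDegree : ℤ) - q + 1 + (i : ℕ) + ((q - (i + 1) : ℕ) : ℤ)) = P.natDegree := by
      omega
    rw [hidx, taylorCoeffInt, if_neg (by omega), hcoeff, Int.toNat_natCast, coeff_taylor_natDegree]
    exact leadingCoeff_ne_zero.2 hP
  rw [Matrix.det_permute'] at hdet
  exact right_ne_zero_of_mul hdet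

theorem ratFuncDist_pade_of_eventuallyEq_polynomial {f : ℂ → ℂ} {ζ : ℂ} {P : ℂ[X]}
    (hP : P ≠ 0) (hf : f =ᶠ[𝓝 ζ] fun z => P.eval z) (q : ℕ) (z w : ℂ) :
    ratFuncDist (pade f ζ P.natDegree q) z w = ‖P.eval z - w‖ₑ := by
  have hpair : PadePair f ζ P.natDegree q P 1 := by
    refine ⟨le_rfl, by simp, by simp, ?_⟩
    rw [taylorPowerSeries_congr hf, taylorPowerSeries_polynomial_eval]
    simp
  have hc := inPadeClass_of_eventuallyEq_polynomial hP hf q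
  obtain ⟨e1, e2⟩ := hc.eq_of_padePair hpair
  rw [hc.ratFuncDist_pade w (by rw [← e2]; simp), ← e1, ← e2]
  simp

/-! ### Continuity in the function and the center, and openness -/

theorem zeroExt_apply {Ω : Set ℂ} (f : C(Ω, ℂ)) (z : Ω) : zeroExt f z = f z :=
  Subtype.val_injective.extend_apply _ _ _

theorem tendstoLocallyUniformlyOn_zeroExt {Ω : Set ℂ} (hΩ : IsOpen Ω) (f : C(Ω, ℂ)) :
    TendstoLocallyUniformlyOn (fun g : C(Ω, ℂ) => zeroExt g) (zeroExt f) (𝓝 f) Ω := by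
  have : LocallyCompactSpace Ω := hΩ.locallyCompactSpace
  have h := (ContinuousMap.tendsto_iff_tendstoLocallyUniformly (f := f)).1
    (tendsto_id (α := C(Ω, ℂ)) (x := 𝓝 f))
  rw [tendstoLocallyUniformlyOn_iff_tendstoLocallyUniformly_comp_coe]
  convert h using 1
  · funext g z
    exact zeroExt_apply g z
  · funext z
    exact zeroExt_apply f z

theorem isClosed_setOf_differentiableOn_zeroExt {Ω : Set ℂ} (hΩ : IsOpen Ω) :
    IsClosed {f : C(Ω, ℂ) | DifferentiableOn ℂ (zeroExt f) Ω} := by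
  rw [isClosed_iff_frequently]
  intro f hf
  have hne : (𝓝 f ⊓ 𝓟 {f : C(Ω, ℂ) | DifferentiableOn ℂ (zeroExt f) Ω}).NeBot :=
    frequently_mem_iff_neBot.1 hf
  have h := tendstoLocallyUniformlyOn_zeroExt hΩ f
  have h' : TendstoLocallyUniformlyOn (fun g : C(Ω, ℂ) => zeroExt g) (zeroExt f)
      (𝓝 f ⊓ 𝓟 {f : C(Ω, ℂ) | DifferentiableOn ℂ (zeroExt f) Ω}) Ω := fun u hu z hz => by
    obtain ⟨t, ht, hev⟩ := h u hu z hz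
    exact ⟨t, ht, hev.filter_mono inf_le_left⟩
  exact h'.differentiableOn (eventually_inf_principal.2 (Eventually.of_forall fun _ h => h)) hΩ

theorem tendstoLocallyUniformlyOn_iteratedDeriv {Ω : Set ℂ} (hΩ : IsOpen Ω) (f : HolSpace Ω)
    (n : ℕ) : TendstoLocallyUniformlyOn (fun g : HolSpace Ω => iteratedDeriv n (zeroExt g.1))
      (iteratedDeriv n (zeroExt f.1)) (𝓝 f) Ω := by
  have hd : ∀ (n : ℕ) (g : HolSpace Ω), DifferentiableOn ℂ (iteratedDeriv n (zeroExt g.1)) Ω := by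
    intro n g
    induction n with
    | zero => simpa using g.2
    | succ n ih =>
      rw [iteratedDeriv_succ]
      exact ih.deriv hΩ
  induction n with
  | zero =>
    simp only [iteratedDeriv_zero]
    intro u hu z hz
    obtain ⟨t, ht, hev⟩ := tendstoLocallyUniformlyOn_zeroExt hΩ f.1 u hu z hz
    exact ⟨t, ht, continuous_subtype_val.continuousAt.eventually hev⟩
  | succ n ih =>
    simp only [iteratedDeriv_succ]
    exact ih.deriv (Eventually.of_forall fun g => hd n g) hΩ

/-- Derivatives converge locally uniformly as the function varies (Weierstrass), and the limit is
continuous; together this gives joint continuity. -/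
theorem continuousAt_iteratedDeriv_zeroExt {Ω : Set ℂ} (hΩ : IsOpen Ω) (f : HolSpace Ω) {ζ : ℂ}
    (hζ : ζ ∈ Ω) (n : ℕ) :
    ContinuousAt (fun x : HolSpace Ω × ℂ => iteratedDeriv n (zeroExt x.1.1) x.2) (f, ζ) := by
  have h := tendstoLocallyUniformlyOn_iteratedDeriv hΩ f n
  have hc : ContinuousWithinAt (iteratedDeriv n (zeroExt f.1)) Ω ζ := by
    have ha : AnalyticAt ℂ (zeroExt f.1) ζ := f.2.analyticAt (hΩ.mem_nhds hζ)
    rw [iteratedDeriv_eq_iterate]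
    exact (ha.iterated_deriv n).continuousAt.continuousWithinAt
  have h' : TendstoLocallyUniformlyOn
      (fun x : HolSpace Ω × ℂ => iteratedDeriv n (zeroExt x.1.1))
      (iteratedDeriv n (zeroExt f.1)) (𝓝 (f, ζ)) Ω := by
    intro u hu z hz
    obtain ⟨t, ht, hev⟩ := h u hu z hz
    exact ⟨t, ht, (continuous_fst.tendsto (f, ζ)).eventually hev⟩
  refine h'.tendsto_comp hc hζ ?_
  rw [hΩ.nhdsWithin_eq hζ]
  exact continuous_snd.tendsto (f, ζ)

theorem continuousAt_taylorCoeff {Ω : Set ℂ} (hΩ : IsOpen Ω) (f : HolSpace Ω) {ζ : ℂ}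
    (hζ : ζ ∈ Ω) (n : ℕ) :
    ContinuousAt (fun x : HolSpace Ω × ℂ => taylorCoeff (zeroExt x.1.1) x.2 n) (f, ζ) :=
  (continuousAt_iteratedDeriv_zeroExt hΩ f hζ n).div_const _

theorem continuousAt_hankelMatrix {Ω : Set ℂ} (hΩ : IsOpen Ω) (f : HolSpace Ω) {ζ : ℂ}
    (hζ : ζ ∈ Ω) (p q : ℕ) :
    ContinuousAt (fun x : HolSpace Ω × ℂ => hankelMatrix (zeroExt x.1.1) x.2 p q) (f, ζ) := by
  refine continuousAt_pi.2 fun i => continuousAt_pi.2 fun j => ?_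
  simp only [hankelMatrix, Matrix.of_apply, taylorCoeffInt]
  split_ifs
  · exact continuousAt_const
  · exact continuousAt_taylorCoeff hΩ f hζ _

theorem eventually_inPadeClass {Ω : Set ℂ} (hΩ : IsOpen Ω) {f : HolSpace Ω} {ζ : ℂ}
    (hζ : ζ ∈ Ω) {p q : ℕ} (h : InPadeClass (zeroExt f.1) ζ p q) :
    ∀ᶠ x : HolSpace Ω × ℂ in 𝓝 (f, ζ), InPadeClass (zeroExt x.1.1) x.2 p q := by
  have hdet : Continuous fun H : Matrix (Fin q) (Fin q) ℂ => H.det := continuous_id.matrix_det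
  exact (hdet.continuousAt.comp (continuousAt_hankelMatrix hΩ f hζ p q)).eventually_ne h

/-- Cramer's rule: the inverse is the adjugate divided by a determinant that is nonzero at the base
point. -/
theorem continuousAt_padeVec {Ω : Set ℂ} (hΩ : IsOpen Ω) {f : HolSpace Ω} {ζ : ℂ}
    (hζ : ζ ∈ Ω) {p q : ℕ} (h : InPadeClass (zeroExt f.1) ζ p q) :
    ContinuousAt (fun x : HolSpace Ω × ℂ => padeVec (zeroExt x.1.1) x.2 p q) (f, ζ) := by
  have hdet : Continuous fun H : Matrix (Fin q) (Fin q) ℂ => H.det := continuous_id.matrix_det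
  have hadj : Continuous fun H : Matrix (Fin q) (Fin q) ℂ => H.adjugate :=
    continuous_id.matrix_adjugate
  have hH := continuousAt_hankelMatrix hΩ f hζ p q
  have h1 : ContinuousAt (fun x : HolSpace Ω × ℂ =>
      ((hankelMatrix (zeroExt x.1.1) x.2 p q).det)⁻¹) (f, ζ) :=
    (hdet.continuousAt.comp hH).inv₀ h
  have h2 : ContinuousAt (fun x : HolSpace Ω × ℂ =>
      (hankelMatrix (zeroExt x.1.1) x.2 p q).adjugate) (f, ζ) := hadj.continuousAt.comp hH
  refine continuousAt_pi.2 fun i => ?_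
  simp only [padeVec, Matrix.inv_def, Ring.inverse_eq_inv', Matrix.mulVec, dotProduct,
    Matrix.smul_apply, smul_eq_mul]
  refine tendsto_finsetSum _ fun j _ => ?_
  have h3 := continuousAt_pi.1 (continuousAt_pi.1 h2 i) j
  exact (h1.mul h3).mul (continuousAt_taylorCoeff hΩ f hζ _).neg

theorem continuousAt_padeDenCoeff {Ω : Set ℂ} (hΩ : IsOpen Ω) {f : HolSpace Ω} {ζ : ℂ}
    (hζ : ζ ∈ Ω) {p q : ℕ} (h : InPadeClass (zeroExt f.1) ζ p q) (i : ℕ) :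
    ContinuousAt (fun x : HolSpace Ω × ℂ => padeDenCoeff (zeroExt x.1.1) x.2 p q i) (f, ζ) := by
  simp only [padeDenCoeff]
  split_ifs
  · exact continuousAt_pi.1 (continuousAt_padeVec hΩ hζ h) _
  · exact continuousAt_const
  · exact continuousAt_const

theorem continuousAt_padeNumCoeff {Ω : Set ℂ} (hΩ : IsOpen Ω) {f : HolSpace Ω} {ζ : ℂ}
    (hζ : ζ ∈ Ω) {p q : ℕ} (h : InPadeClass (zeroExt f.1) ζ p q) (i : ℕ) :
    ContinuousAt (fun x : HolSpace Ω × ℂ => padeNumCoeff (zeroExt x.1.1) x.2 p q i) (f, ζ) := by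
  simp only [padeNumCoeff]
  exact tendsto_finsetSum _ fun j _ =>
    (continuousAt_padeDenCoeff hΩ hζ h _).mul (continuousAt_taylorCoeff hΩ f hζ _)

theorem eval_taylor_neg_sum (b : ℕ → ℂ) (m : ℕ) (ζ z : ℂ) :
    (taylor (-ζ) (∑ i ∈ Finset.range (m + 1), monomial i (b i))).eval z =
      ∑ i ∈ Finset.range (m + 1), b i * (z - ζ) ^ i := by
  rw [taylor_eval, eval_finsetSum]
  simp [sub_eq_add_neg]

theorem continuousAt_eval_padeDen {Ω : Set ℂ} (hΩ : IsOpen Ω) {f : HolSpace Ω} {ζ : ℂ}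
    (hζ : ζ ∈ Ω) {p q : ℕ} (h : InPadeClass (zeroExt f.1) ζ p q) (z : ℂ) :
    ContinuousAt (fun x : HolSpace Ω × ℂ × ℂ => (padeDen (zeroExt x.1.1) x.2.1 p q).eval x.2.2)
      (f, ζ, z) := by
  simp only [padeDen, eval_taylor_neg_sum]
  refine tendsto_finsetSum _ fun i _ => ?_
  have h1 : ContinuousAt (fun x : HolSpace Ω × ℂ × ℂ => (x.1, x.2.1)) (f, ζ, z) := by fun_prop
  have h2 := ContinuousAt.comp (x := (f, ζ, z)) (f := fun x : HolSpace Ω × ℂ × ℂ => (x.1, x.2.1))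
    (continuousAt_padeDenCoeff hΩ hζ h i) h1
  have h3 : ContinuousAt (fun x : HolSpace Ω × ℂ × ℂ => (x.2.2 - x.2.1) ^ i) (f, ζ, z) := by
    fun_prop
  exact h2.mul h3

theorem continuousAt_eval_padeNum {Ω : Set ℂ} (hΩ : IsOpen Ω) {f : HolSpace Ω} {ζ : ℂ}
    (hζ : ζ ∈ Ω) {p q : ℕ} (h : InPadeClass (zeroExt f.1) ζ p q) (z : ℂ) :
    ContinuousAt (fun x : HolSpace Ω × ℂ × ℂ => (padeNum (zeroExt x.1.1) x.2.1 p q).eval x.2.2)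
      (f, ζ, z) := by
  simp only [padeNum, eval_taylor_neg_sum]
  refine tendsto_finsetSum _ fun i _ => ?_
  have h1 : ContinuousAt (fun x : HolSpace Ω × ℂ × ℂ => (x.1, x.2.1)) (f, ζ, z) := by fun_prop
  have h2 := ContinuousAt.comp (x := (f, ζ, z)) (f := fun x : HolSpace Ω × ℂ × ℂ => (x.1, x.2.1))
    (continuousAt_padeNumCoeff hΩ hζ h i) h1
  have h3 : ContinuousAt (fun x : HolSpace Ω × ℂ × ℂ => (x.2.2 - x.2.1) ^ i) (f, ζ, z) := by
    fun_prop
  exact h2.mul h3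

theorem isOpen_setOf_inPadeClass {Ω : Set ℂ} (hΩ : IsOpen Ω) {L : Set ℂ} (hL : IsCompact L)
    (hLΩ : L ⊆ Ω) (p q : ℕ) :
    IsOpen {f : HolSpace Ω | ∀ ζ ∈ L, InPadeClass (zeroExt f.1) ζ p q} := by
  rw [isOpen_iff_mem_nhds]
  intro f hf
  exact hL.eventually_forall_of_forall_eventually fun ζ hζ =>
    eventually_inPadeClass hΩ (hLΩ hζ) (hf ζ hζ)

/-- The functions whose Padé approximants with centers in `L` are `δ`-close on `S` to a target
`G f`, which may depend on the function `f`. -/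
def padeNear (Ω L S : Set ℂ) (p q : ℕ) (G : HolSpace Ω → ℂ → ℂ) (δ : ℝ≥0∞) : Set (HolSpace Ω) :=
  {f | ∀ x ∈ L ×ˢ S, InPadeClass (zeroExt f.1) x.1 p q ∧
    ratFuncDist (pade (zeroExt f.1) x.1 p q) x.2 (G f x.2) < δ}

theorem isOpen_padeNear {Ω : Set ℂ} (hΩ : IsOpen Ω) {L S : Set ℂ} (hL : IsCompact L)
    (hLΩ : L ⊆ Ω) (hS : IsCompact S) (p q : ℕ) {G : HolSpace Ω → ℂ → ℂ}
    (hG : ∀ f, ∀ z ∈ S, ContinuousAt (fun x : HolSpace Ω × ℂ => G x.1 x.2) (f, z)) (δ : ℝ≥0∞) :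
    IsOpen (padeNear Ω L S p q G δ) := by
  rw [isOpen_iff_mem_nhds]
  intro f hf
  refine (hL.prod hS).eventually_forall_of_forall_eventually
    (P := fun (f : HolSpace Ω) (x : ℂ × ℂ) => InPadeClass (zeroExt f.1) x.1 p q ∧
    ratFuncDist (pade (zeroExt f.1) x.1 p q) x.2 (G f x.2) < δ) ?_
  rintro ⟨ζ, z⟩ hx
  obtain ⟨hc, hlt⟩ := hf (ζ, z) hx
  have hζ : ζ ∈ Ω := hLΩ hx.1
  -- A distance below `δ` is finite, so `z` is not a pole and the quotient is continuous there.
  have hd := hc.padeDen_eval_ne_zero (ne_top_of_lt hlt)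
  rw [hc.ratFuncDist_pade _ hd] at hlt
  have c1 := continuousAt_eval_padeDen hΩ hζ hc z
  have c2 := continuousAt_eval_padeNum hΩ hζ hc z
  have h1 : ContinuousAt (fun x : HolSpace Ω × ℂ × ℂ => (x.1, x.2.1)) (f, ζ, z) := by fun_prop
  have h2 : ContinuousAt (fun x : HolSpace Ω × ℂ × ℂ => (x.1, x.2.2)) (f, ζ, z) := by fun_prop
  have c3 := ContinuousAt.comp (x := (f, ζ, z))
    (f := fun x : HolSpace Ω × ℂ × ℂ => (x.1, x.2.2)) (hG f z hx.2) h2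
  have e1 := h1.eventually (eventually_inPadeClass hΩ hζ hc)
  have e2 := c1.eventually_ne hd
  have e3 := ((c2.div c1 hd).sub c3).enorm.eventually_lt_const hlt
  filter_upwards [e1, e2, e3] with y hy1 hy2 hy3
  refine ⟨hy1, ?_⟩
  rw [InPadeClass.ratFuncDist_pade hy1 _ hy2]
  exact hy3

/-- The functions in the class `𝔇_{p,q}(ζ)` for all `ζ ∈ L` whose Padé approximants with centers in
`L` are `δ`-close to `h` on `K` and to the function on `L'`. -/
def padeGood (Ω L L' K : Set ℂ) (p q : ℕ) (h : ℂ[X]) (δ : ℝ≥0∞) : Set (HolSpace Ω) :=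
  {f : HolSpace Ω | ∀ ζ ∈ L, InPadeClass (zeroExt f.1) ζ p q} ∩
    padeNear Ω L K p q (fun _ z => h.eval z) δ ∩ padeNear Ω L L' p q (fun f => zeroExt f.1) δ

theorem isOpen_padeGood {Ω : Set ℂ} (hΩ : IsOpen Ω) {L L' K : Set ℂ} (hL : IsCompact L)
    (hLΩ : L ⊆ Ω) (hL' : IsCompact L') (hL'Ω : L' ⊆ Ω) (hK : IsCompact K) (p q : ℕ) (h : ℂ[X])
    (δ : ℝ≥0∞) : IsOpen (padeGood Ω L L' K p q h δ) := by
  -- The class condition is a separate factor because `padeNear` says nothing about it when `K` and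
  -- `L'` are empty.
  refine ((isOpen_setOf_inPadeClass hΩ hL hLΩ p q).inter
    (isOpen_padeNear hΩ hL hLΩ hK p q (fun f z _ => ?_) δ)).inter
    (isOpen_padeNear hΩ hL hLΩ hL' p q (fun f z hz => ?_) δ)
  · exact (h.continuous.comp continuous_snd).continuousAt
  · simpa using continuousAt_iteratedDeriv_zeroExt hΩ f (hL'Ω hz) 0

/-! ### Density -/

/-- A polynomial, as a holomorphic function on an open set. -/
def holPolynomial (Ω : Set ℂ) (P : ℂ[X]) : HolSpace Ω :=
  ⟨⟨fun z => P.eval (z : ℂ), by fun_prop⟩,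
    P.differentiable.differentiableOn.congr fun z hz => zeroExt_apply _ ⟨z, hz⟩⟩

theorem zeroExt_holPolynomial {Ω : Set ℂ} (P : ℂ[X]) {z : ℂ} (hz : z ∈ Ω) :
    zeroExt (holPolynomial Ω P).1 z = P.eval z :=
  zeroExt_apply _ ⟨z, hz⟩

theorem holPolynomial_mem_padeGood {Ω : Set ℂ} (hΩ : IsOpen Ω) {L L' K : Set ℂ}
    (hLΩ : L ⊆ Ω) (hL'Ω : L' ⊆ Ω) {P h : ℂ[X]} (hP : P ≠ 0) (q : ℕ) {δ : ℝ≥0∞} (hδ : 0 < δ)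
    (hPh : ∀ z ∈ K, ‖P.eval z - h.eval z‖ₑ < δ) :
    holPolynomial Ω P ∈ padeGood Ω L L' K P.natDegree q h δ := by
  have hev : ∀ ζ ∈ L, zeroExt (holPolynomial Ω P).1 =ᶠ[𝓝 ζ] fun z => P.eval z := fun ζ hζ => by
    filter_upwards [hΩ.mem_nhds (hLΩ hζ)] with z hz
    exact zeroExt_holPolynomial P hz
  refine ⟨⟨fun ζ hζ => inPadeClass_of_eventuallyEq_polynomial hP (hev ζ hζ) q, ?_⟩, ?_⟩
  · rintro ⟨ζ, z⟩ ⟨hζ, hz⟩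
    refine ⟨inPadeClass_of_eventuallyEq_polynomial hP (hev ζ hζ) q, ?_⟩
    rw [ratFuncDist_pade_of_eventuallyEq_polynomial hP (hev ζ hζ)]
    exact hPh z hz
  · rintro ⟨ζ, z⟩ ⟨hζ, hz⟩
    refine ⟨inPadeClass_of_eventuallyEq_polynomial hP (hev ζ hζ) q, ?_⟩
    rw [ratFuncDist_pade_of_eventuallyEq_polynomial hP (hev ζ hζ)]
    beta_reduce
    rw [zeroExt_holPolynomial P (hL'Ω hz), sub_self, enorm_zero]
    exact hδ

theorem exists_compact_of_mem_nhds {Ω : Set ℂ} {f : HolSpace Ω} {N : Set (HolSpace Ω)}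
    (hN : N ∈ 𝓝 f) : ∃ M ⊆ Ω, IsCompact M ∧ ∃ ε > 0, ∀ g : HolSpace Ω,
      (∀ z ∈ M, ‖zeroExt g.1 z - zeroExt f.1 z‖ < ε) → g ∈ N := by
  obtain ⟨N', hN', hsub⟩ := mem_nhds_subtype _ _ _ |>.1 hN
  obtain ⟨⟨M, ε⟩, ⟨hM, hε⟩, hMε⟩ := (nhds_basis_uniformity
    (Metric.uniformity_basis_dist (α := ℂ)).compactConvergenceUniformity).mem_iff.1 hN'
  refine ⟨Subtype.val '' M, by rintro _ ⟨z, -, rfl⟩; exact z.2,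
    hM.image continuous_subtype_val, ε, hε, fun g hg => hsub (hMε fun z hz => ?_)⟩
  have := hg z ⟨z, hz, rfl⟩
  rw [zeroExt_apply, zeroExt_apply] at this
  rw [Set.mem_ofPred_eq, dist_eq_norm]
  exact this

theorem exists_natDegree_eq_near (P : ℂ[X]) {p : ℕ} (hp : P.natDegree < p) {M : Set ℂ}
    (hM : Bornology.IsBounded M) {ε : ℝ} (hε : 0 < ε) :
    ∃ Q : ℂ[X], Q.natDegree = p ∧ ∀ z ∈ M, ‖Q.eval z - P.eval z‖ < ε := by
  obtain ⟨R, hR⟩ := hM.exists_norm_le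
  have hpos : 0 < |R| ^ p + 1 := by positivity
  -- Chosen so that `d |z| ^ p ≤ ε / 2` on `M`; the `+ 1` keeps the divisor positive.
  set d : ℝ := ε / (|R| ^ p + 1) / 2 with hd
  have hd0 : 0 < d := by positivity
  have hdc : (d : ℂ) ≠ 0 := by exact_mod_cast hd0.ne'
  refine ⟨P + C (d : ℂ) * X ^ p, ?_, fun z hz => ?_⟩
  · rw [natDegree_add_eq_right_of_natDegree_lt, natDegree_C_mul_X_pow _ _ hdc]
    rwa [natDegree_C_mul_X_pow _ _ hdc]
  · simp only [eval_add, eval_mul, eval_C, eval_pow, eval_X, add_sub_cancel_left, norm_mul,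
      norm_pow, Complex.norm_real, Real.norm_of_nonneg hd0.le]
    have h1 : ‖z‖ ^ p ≤ |R| ^ p :=
      pow_le_pow_left₀ (norm_nonneg _) ((hR z hz).trans (le_abs_self R)) _
    calc d * ‖z‖ ^ p ≤ d * (|R| ^ p + 1) := by gcongr; linarith
      _ = ε / 2 := by rw [hd]; field_simp
      _ < ε := half_lt_self hε

theorem dense_iUnion_padeGood {F : Set (ℕ × ℕ)}
    (hF : ∃ s : ℕ → ℕ × ℕ, (∀ n, s n ∈ F) ∧ Tendsto (fun n => (s n).1) atTop atTop)
    {Ω : Set ℂ} (hΩ : IsSimplyConnectedOpen Ω) {L L' K : Set ℂ} (hLΩ : L ⊆ Ω) (hL'Ω : L' ⊆ Ω)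
    (hK : IsCompact K) (hKΩ : K ⊆ Ωᶜ) (hKc : IsPreconnected Kᶜ) (h : ℂ[X]) {δ : ℝ≥0∞}
    (hδ : 0 < δ) : Dense (⋃ x ∈ F, padeGood Ω L L' K x.1 x.2 h δ) := by
  rw [dense_iff_inter_open]
  rintro U hU ⟨f, hf⟩
  obtain ⟨M, hMΩ, hM, ε, hε, hMε⟩ := exists_compact_of_mem_nhds (hU.mem_nhds hf)
  obtain ⟨η, hη, hηδ⟩ : ∃ η : ℝ, 0 < η ∧ ENNReal.ofReal η ≤ δ := by
    rcases eq_or_ne δ ⊤ with rfl | hne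
    · exact ⟨1, one_pos, le_top⟩
    · exact ⟨δ.toReal, ENNReal.toReal_pos hδ.ne' hne, ENNReal.ofReal_toReal_le⟩
  set r : ℝ := min ε η / 2 with hr
  have hr0 : 0 < r := by positivity
  obtain ⟨P, hP1, hP2⟩ := hΩ.exists_polynomial_near hM hMΩ hK hKΩ hKc f.2 h hr0
  obtain ⟨s, hsF, hs⟩ := hF
  -- The unbounded first indices in `F` are needed exactly here: the degree can only be raised. The
  -- second index plays no role.
  obtain ⟨n, hn⟩ := (hs.eventually_gt_atTop P.natDegree).exists
  obtain ⟨Q, hQd, hQ⟩ := exists_natDegree_eq_near P hn (hM.union hK).isBounded hr0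
  have hQ0 : Q ≠ 0 := by
    rintro rfl
    rw [natDegree_zero] at hQd
    omega
  have hrε : r + r ≤ ε := by rw [hr, add_halves]; exact min_le_left _ _
  have hrη : r + r ≤ η := by rw [hr, add_halves]; exact min_le_right _ _
  refine ⟨holPolynomial Ω Q, hMε _ fun z hz => ?_, Set.mem_biUnion (hsF n) ?_⟩
  · rw [zeroExt_holPolynomial Q (hMΩ hz)]
    have h1 := norm_sub_le_norm_sub_add_norm_sub (Q.eval z) (P.eval z) (zeroExt f.1 z)
    linarith [hP1 z hz, hQ z (Or.inl hz)]
  · rw [← hQd]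
    refine holPolynomial_mem_padeGood hΩ.1 hLΩ hL'Ω hQ0 _ hδ fun z hz => ?_
    have h1 := norm_sub_le_norm_sub_add_norm_sub (Q.eval z) (P.eval z) (h.eval z)
    rw [← ofReal_norm]
    refine lt_of_lt_of_le ((ENNReal.ofReal_lt_ofReal_iff hη).2 ?_) hηδ
    linarith [hP2 z hz, hQ z (Or.inr hz)]

/-! ### The countable intersection and the Baire property -/

theorem exists_seq_polynomial_dense {K : Set ℂ} (hK : IsCompact K) :
    ∃ H : ℕ → ℂ[X], ∀ (h : ℂ[X]) (ε : ℝ), 0 < ε → ∃ k, ∀ z ∈ K, ‖(H k).eval z - h.eval z‖ < ε := by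
  have : CompactSpace K := isCompact_iff_compactSpace.1 hK
  let T : ℂ[X] → C(K, ℂ) := fun P => ⟨fun z => P.eval (z : ℂ), by fun_prop⟩
  have : Nonempty (Set.range T) := ⟨⟨T 0, 0, rfl⟩⟩
  -- The dense sequence is taken inside the range of `T`, itself separable, so that its terms come
  -- from polynomials.
  choose H hH using fun k => (TopologicalSpace.denseSeq (Set.range T) k).2
  refine ⟨H, fun h ε hε => ?_⟩
  obtain ⟨k, hk⟩ := (TopologicalSpace.denseRange_denseSeq (Set.range T)).exists_dist_lt
    ⟨T h, h, rfl⟩ hε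
  refine ⟨k, fun z hz => ?_⟩
  have h1 : dist (T h) (T (H k)) < ε := by
    rw [hH k]
    exact hk
  have h2 := (ContinuousMap.dist_lt_iff hε).1 h1 ⟨z, hz⟩
  rw [dist_comm, dist_eq_norm] at h2
  exact h2

theorem ratFuncDist_triangle (Φ : RatFunc ℂ) (z v w : ℂ) :
    ratFuncDist Φ z w ≤ ratFuncDist Φ z v + ‖v - w‖ₑ := by
  rw [ratFuncDist, ratFuncDist]
  split_ifs
  · simp
  · refine le_trans (le_of_eq ?_) (enorm_add_le _ _)
    congr 1
    ring

theorem universalPade_eq_iInter {F : Set (ℕ × ℕ)} {Ω L L' K : Set ℂ} {H : ℕ → ℂ[X]}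
    (hH : ∀ (h : ℂ[X]) (ε : ℝ), 0 < ε → ∃ k, ∀ z ∈ K, ‖(H k).eval z - h.eval z‖ < ε) :
    universalPade F Ω L L' K = ⋂ y : ℕ × ℕ, ⋃ x ∈ F,
      padeGood Ω L L' K x.1 x.2 (H y.1) (ENNReal.ofReal (1 / ((y.2 : ℝ) + 1))) := by
  have hpos : ∀ n : ℕ, 0 < 1 / ((n : ℝ) + 1) := fun n => by positivity
  ext f
  simp only [Set.mem_iInter, Set.mem_iUnion, exists_prop]
  constructor
  · rintro hf ⟨k, n⟩
    obtain ⟨s, hsF, hc, h1, h2⟩ := hf (H k)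
    have hδ : (0 : ℝ≥0∞) < ENNReal.ofReal (1 / ((n : ℝ) + 1)) := ENNReal.ofReal_pos.2 (hpos n)
    obtain ⟨m, hm1, hm2⟩ :=
      ((h1.eventually_lt_const hδ).and (h2.eventually_lt_const hδ)).exists
    refine ⟨s m, hsF m, ⟨hc m, ?_⟩, ?_⟩
    · rintro ⟨ζ, z⟩ ⟨hζ, hz⟩
      refine ⟨hc m ζ hζ, lt_of_le_of_lt ?_ hm1⟩
      exact (le_iSup₂_of_le ζ hζ (le_iSup₂_of_le z hz le_rfl))
    · rintro ⟨ζ, z⟩ ⟨hζ, hz⟩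
      refine ⟨hc m ζ hζ, lt_of_le_of_lt ?_ hm2⟩
      exact (le_iSup₂_of_le ζ hζ (le_iSup₂_of_le z hz le_rfl))
  · intro hf h
    choose k hk using fun n : ℕ => hH h _ (hpos n)
    -- The `n`-th pair serves a target `H (k n)` within `1 / (n + 1)` of `h`, so the total error on
    -- `K` is at most `2 / (n + 1)`.
    choose s hsF hs using fun n : ℕ => hf (k n, n)
    have hlim : Tendsto (fun n : ℕ => ENNReal.ofReal (1 / ((n : ℝ) + 1))) atTop (𝓝 0) := by
      simpa using ENNReal.tendsto_ofReal tendsto_one_div_add_atTop_nhds_zero_nat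
    refine ⟨s, hsF, fun n => (hs n).1.1, ?_, ?_⟩
    · refine tendsto_of_tendsto_of_tendsto_of_le_of_le tendsto_const_nhds
        (add_zero (0 : ℝ≥0∞) ▸ hlim.add hlim) (fun _ => zero_le) fun n => ?_
      refine iSup₂_le fun ζ hζ => iSup₂_le fun z hz => ?_
      refine (ratFuncDist_triangle _ z ((H (k n)).eval z) _).trans (add_le_add ?_ ?_)
      · exact ((hs n).1.2 (ζ, z) ⟨hζ, hz⟩).2.le
      · rw [← ofReal_norm]
        exact ENNReal.ofReal_le_ofReal (hk n z hz).le
    · refine tendsto_of_tendsto_of_tendsto_of_le_of_le tendsto_const_nhds hlim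
        (fun _ => zero_le) fun n => ?_
      exact iSup₂_le fun ζ hζ => iSup₂_le fun z hz => ((hs n).2 (ζ, z) ⟨hζ, hz⟩).2.le

/-- By Weierstrass's theorem the holomorphic functions form a closed subspace of the completely
metrizable space `C(Ω, ℂ)`. -/
theorem baireSpace_holSpace {Ω : Set ℂ} (hΩ : IsOpen Ω) : BaireSpace (HolSpace Ω) := by
  have : LocallyCompactSpace Ω := hΩ.locallyCompactSpace
  have : TopologicalSpace.IsCompletelyPseudoMetrizableSpace (HolSpace Ω) :=
    (isClosed_setOf_differentiableOn_zeroExt hΩ).isCompletelyPseudoMetrizableSpace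
  infer_instance

end

theorem theorem3p1 (F : Set (ℕ × ℕ))
    (hF : ∃ s : ℕ → ℕ × ℕ, (∀ n, s n ∈ F) ∧ Tendsto (fun n => (s n).1) atTop atTop)
    (Ω : Set ℂ) (hΩ : IsSimplyConnectedOpen Ω)
    (L L' : Set ℂ) (hL : IsCompact L) (hLΩ : L ⊆ Ω) (hL' : IsCompact L') (hL'Ω : L' ⊆ Ω)
    (K : Set ℂ) (hK : IsCompact K) (hKΩ : K ⊆ Ωᶜ) (hKc : IsConnected Kᶜ) :
    (universalPade F Ω L L' K).Nonempty ∧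
      Dense (universalPade F Ω L L' K) ∧ IsGδ (universalPade F Ω L L' K) := by
  obtain ⟨H, hH⟩ := exists_seq_polynomial_dense hK
  have := baireSpace_holSpace hΩ.1
  have hopen : ∀ y : ℕ × ℕ, IsOpen (⋃ x ∈ F,
      padeGood Ω L L' K x.1 x.2 (H y.1) (ENNReal.ofReal (1 / ((y.2 : ℝ) + 1)))) := fun y =>
    isOpen_biUnion fun x _ => isOpen_padeGood hΩ.1 hL hLΩ hL' hL'Ω hK _ _ _ _
  have hdense : Dense (universalPade F Ω L L' K) := by
    rw [universalPade_eq_iInter hH]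
    refine dense_iInter_of_isOpen hopen fun y => ?_
    exact dense_iUnion_padeGood hF hΩ hLΩ hL'Ω hK hKΩ hKc.isPreconnected _
      (ENNReal.ofReal_pos.2 (by positivity))
  have : Nonempty (HolSpace Ω) := ⟨holPolynomial Ω 0⟩
  refine ⟨hdense.nonempty, hdense, ?_⟩
  rw [universalPade_eq_iInter hH]
  exact IsGδ.iInter_of_isOpen hopen
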